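/- Let $\beta>0$ and consider on $\mathbb R^3\times\mathbb R$ the system $$i\partial_tu+\Delta u+(|u|^2+\beta|v|^2)u=0,\qquad i\partial_tv+\Delta v+(|v|^2+\beta|u|^2)v=0,$$ for complex-valued $u,v$, with solutions understood as distributional solutions in $C(I;H^1\times H^1)$, $H^1=H^1(\mathbb R^3)$, on an open time interval $I\ni 0$. Put $$M(u,v)=\int_{\mathbb R^3}(|u|^2+|v|^2)\,dx,\qquad A(u,v)=\int_{\mathbb R^3}(|\nabla u|^2+|\nabla v|^2)\,dx,$$ $$E(u,v)=\tfrac12A(u,v)-\tfrac14\int_{\mathbb R^3}(|u|^4+2\beta|uv|^2+|v|^4)\,dx.$$ Let $(P,Q)\in H^1\times H^1$ be a ground state, that is, a weak solution $(P,Q)\ne(0,0)$ of $$-\Delta P+P-(|P|^2+\beta|Q|^2)P=0,\qquad -\Delta Q+Q-(|Q|^2+\beta|P|^2)Q=0,$$ whose action $E+\tfrac12M$ is the least among all nontrivial $H^1$ weak solutions. Fix a number $6^-\in(3,6)$ and, for a time interval $I$, let $$\|u\|_{S(\dot H^{1/2};I)}=\sup\Big\{\|u\|_{L^q_IL^r_x}:\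 \tfrac2q+\tfrac3r=1,\ 3\le r\le 6^-\Big\},\qquad \|(u,v)\|_{S(\dot H^{1/2};I)}=\|u\|_{S(\dot H^{1/2};I)}+\|v\|_{S(\dot H^{1/2};I)}.$$ For $(u_0,v_0)\in H^1\times H^1$ say that $SC(u_0,v_0)$ holds if the maximal $H^1$ solution $(u,v)$ with data $(u_0,v_0)$ at $t=0$ exists for all $t\ge 0$ and $\|(u,v)\|_{S(\dot H^{1/2};I)}<\infty$, where $I$ is its interval of existence. Let $M_c\in[-\infty,\infty]$ be the supremum of all $\delta\in\mathbb R$ such that $SC(u_0,v_0)$ holds for every $(u_0,v_0)\in H^1\times H^1$ with $M(u_0,v_0)A(u_0,v_0)<M(P,Q)A(P,Q)$ and $M(u_0,v_0)E(u_0,v_0)<\delta$. Let $(u_c,v_c)\in C(\mathbb R;H^1\times H^1)$ be a critical solution, that is, a global solution of the system such that, at every time, 1. $M(u_c,v_c)=1$, 2. $E(u_c,v_c)=M_c<M(P,Q)E(P,Q)$, 3. $M(u_c,v_c)A(u_c,v_c)<M(P,Q)A(P,Q)$, and such that 4. $\|(u_c,v_c)\|_{S(\dot H^{1/2};\mathbb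 R)}=\infty$. Let $x\in C([0,\infty);\mathbb R^3)$ be a continuous path such that the set $$\mathcal B=\{(u_c(\cdot-x(t),t),\,v_c(\cdot-x(t),t)):\ t\ge0\}$$ is precompact in $H^1\times H^1$. Then $$\frac{|x(t)|}{t}\to0\qquad\text{as } t\to+\infty.$$ -/

import Mathlib

open MeasureTheory Filter Topology Set
open scoped ENNReal ContDiff

noncomputable section

namespace NLSSystem

/-- Physical space `ℝ³` with its Euclidean norm. -/
abbrev R3 := EuclideanSpace ℝ (Fin 3)

/-- `L²(ℝ³; ℂ)`. -/
abbrev L2 := Lp ℂ 2 (volume : Measure R3)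

/-- The `j`-th partial derivative of a classical function. -/
def pderiv (j : Fin 3) (φ : R3 → ℂ) (x : R3) : ℂ :=
  fderiv ℝ φ x (EuclideanSpace.single j 1)

/-- Test functions: smooth with compact support. -/
def IsTestFunction (φ : R3 → ℂ) : Prop :=
  ContDiff ℝ ∞ φ ∧ HasCompactSupport φ

/-- `g = (g₀, g₁, g₂)` is the weak gradient of `f`. -/
def IsWeakGrad (f : L2) (g : Fin 3 → L2) : Prop :=
  ∀ φ : R3 → ℂ, IsTestFunction φ → ∀ j : Fin 3,
    ∫ x, f x * pderiv j φ x = -∫ x, g j x * φ x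

lemma IsTestFunction.memLp {φ : R3 → ℂ} (h : IsTestFunction φ) :
    MemLp φ 2 (volume : Measure R3) :=
  h.1.continuous.memLp_of_hasCompactSupport h.2

lemma IsTestFunction.memLp_pderiv {φ : R3 → ℂ} (h : IsTestFunction φ) (j : Fin 3) :
    MemLp (pderiv j φ) 2 (volume : Measure R3) := by
  have hc : Continuous (pderiv j φ) :=
    (h.1.continuous_fderiv (by simp)).clm_apply continuous_const
  have hs : HasCompactSupport (pderiv j φ) :=
    (h.2.fderiv (𝕜 := ℝ)).comp_left (g := fun L : R3 →L[ℝ] ℂ => L (EuclideanSpace.single j 1))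
      (by simp)
  exact hc.memLp_of_hasCompactSupport hs

lemma integrable_mul_L2 (f : L2) {φ : R3 → ℂ} (h : MemLp φ 2 (volume : Measure R3)) :
    Integrable (fun x => f x * φ x) :=
  (Lp.memLp f).integrable_mul h

lemma IsWeakGrad.add {f f' : L2} {g g' : Fin 3 → L2} (h : IsWeakGrad f g)
    (h' : IsWeakGrad f' g') : IsWeakGrad (f + f') (fun j => g j + g' j) := by
  intro φ hφ j
  have e1 : ∀ (a b : L2) (ψ : R3 → ℂ), MemLp ψ 2 (volume : Measure R3) →
      ∫ x, (a + b : L2) x * ψ x = (∫ x, a x * ψ x) + ∫ x, b x * ψ x := by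
    intro a b ψ hψ
    rw [← integral_add (integrable_mul_L2 a hψ) (integrable_mul_L2 b hψ)]
    refine integral_congr_ae ?_
    filter_upwards [Lp.coeFn_add a b] with x hx
    rw [hx, Pi.add_apply, add_mul]
  rw [e1 _ _ _ (hφ.memLp_pderiv j), e1 _ _ _ hφ.memLp, h φ hφ j, h' φ hφ j, neg_add]

lemma IsWeakGrad.smul (c : ℂ) {f : L2} {g : Fin 3 → L2} (h : IsWeakGrad f g) :
    IsWeakGrad (c • f) (fun j => c • g j) := by
  intro φ hφ j
  have e1 : ∀ (a : L2) (ψ : R3 → ℂ),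
      ∫ x, (c • a : L2) x * ψ x = c * ∫ x, a x * ψ x := by
    intro a ψ
    rw [← integral_const_mul]
    refine integral_congr_ae ?_
    filter_upwards [Lp.coeFn_smul c a] with x hx
    rw [hx, Pi.smul_apply, smul_eq_mul, mul_assoc]
  rw [e1, e1, h φ hφ j, mul_neg]

lemma isWeakGrad_zero : IsWeakGrad 0 (fun _ => 0) := by
  intro φ _ j
  have e1 : ∀ ψ : R3 → ℂ, ∫ x, (0 : L2) x * ψ x = 0 := by
    intro ψ
    refine integral_eq_zero_of_ae ?_
    filter_upwards [Lp.coeFn_zero ℂ 2 (volume : Measure R3)] with x hx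
    rw [hx]
    simp
  rw [e1, e1, neg_zero]

/-- The pairs `(f, ∇f)` in `L² × (L²)³` whose second entry is the weak gradient of the first. -/
def sobolevGraph : Submodule ℂ (WithLp 2 (L2 × PiLp 2 (fun _ : Fin 3 => L2))) where
  carrier := {p | IsWeakGrad p.fst (fun j => p.snd j)}
  add_mem' := fun h h' => IsWeakGrad.add h h'
  zero_mem' := isWeakGrad_zero
  smul_mem' := fun c _ h => IsWeakGrad.smul c h

/-- The Sobolev space `H¹ = H¹(ℝ³; ℂ)`: the functions `f ∈ L²` with a weak gradient in `L²`,
recorded together with `∇f`, which is determined by `f`. The inherited norm is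
`(‖f‖² + ‖∇f‖²)^(1/2)`, which is equivalent to the Fourier norm `‖⟨ξ⟩ f̂‖`. -/
abbrev H1 : Type := sobolevGraph

/-- The function underlying an element of `H¹`. -/
def H1.fn (f : H1) : R3 → ℂ := f.1.fst

/-- The `j`-th weak partial derivative of an element of `H¹`. -/
def H1.grad (f : H1) (j : Fin 3) : R3 → ℂ := f.1.snd j

/-- Translation `f ↦ f(· - a)` on `L²`. -/
def translateL2 (a : R3) (f : L2) : L2 :=
  Lp.compMeasurePreserving (fun x => x - a) (measurePreserving_sub_right volume a) f

lemma coeFn_translateL2 (a : R3) (f : L2) :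
    translateL2 a f =ᵐ[volume] fun x => f (x - a) :=
  Lp.coeFn_compMeasurePreserving f (measurePreserving_sub_right volume a)

lemma integral_translateL2_mul (a : R3) (f : L2) (ψ : R3 → ℂ) :
    ∫ x, translateL2 a f x * ψ x = ∫ x, f x * ψ (x + a) := by
  have h1 : ∫ x, translateL2 a f x * ψ x = ∫ x, f (x - a) * ψ x := by
    refine integral_congr_ae ?_
    filter_upwards [coeFn_translateL2 a f] with x hx
    rw [hx]
  rw [h1, ← integral_add_right_eq_self (fun x => f (x - a) * ψ x) a]
  simp

lemma IsTestFunction.comp_add {φ : R3 → ℂ} (h : IsTestFunction φ) (a : R3) :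
    IsTestFunction (fun x => φ (x + a)) :=
  ⟨h.1.comp (contDiff_id.add contDiff_const),
    h.2.comp_homeomorph (Homeomorph.addRight a)⟩

lemma IsWeakGrad.translate (a : R3) {f : L2} {g : Fin 3 → L2} (h : IsWeakGrad f g) :
    IsWeakGrad (translateL2 a f) (fun j => translateL2 a (g j)) := by
  intro φ hφ j
  rw [integral_translateL2_mul, integral_translateL2_mul, ← h _ (hφ.comp_add a) j]
  refine integral_congr_ae (Eventually.of_forall fun x => ?_)
  simp only [pderiv]
  rw [fderiv_comp_add_right]

/-- Translation `f ↦ f(· - a)` on `H¹`. -/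
def H1.translate (a : R3) (f : H1) : H1 :=
  ⟨WithLp.toLp 2 (translateL2 a f.1.fst,
      WithLp.toLp 2 (fun j => translateL2 a (f.1.snd j))),
    IsWeakGrad.translate a f.2⟩

/-- Mass `M(u,v) = ∫ |u|² + |v|²`. -/
def mass (u v : H1) : ℝ := ∫ x, (‖u.fn x‖ ^ 2 + ‖v.fn x‖ ^ 2)

/-- `A(u,v) = ∫ |∇u|² + |∇v|²`. -/
def gradSq (u v : H1) : ℝ := ∫ x, ∑ j, (‖u.grad j x‖ ^ 2 + ‖v.grad j x‖ ^ 2)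

/-- Energy `E(u,v) = ½ A(u,v) - ¼ ∫ |u|⁴ + 2β|uv|² + |v|⁴`. -/
def energy (β : ℝ) (u v : H1) : ℝ :=
  1 / 2 * gradSq u v -
    1 / 4 * ∫ x, (‖u.fn x‖ ^ 4 + 2 * β * ‖u.fn x * v.fn x‖ ^ 2 + ‖v.fn x‖ ^ 4)

/-- The nonlinearity `(|u|² + β|v|²) u`, as a function on `ℝ³`. -/
def nonlin (β : ℝ) (u v : H1) (x : R3) : ℂ :=
  ((‖u.fn x‖ ^ 2 + β * ‖v.fn x‖ ^ 2 : ℝ) : ℂ) * u.fn x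

/-- The distributional pairing `⟨-Δu, φ⟩ = ∫ ∇u · ∇φ` (no complex conjugation). -/
def dirichlet (u : H1) (φ : R3 → ℂ) : ℂ := ∫ x, ∑ j, u.grad j x * pderiv j φ x

/-- `(u, v) ∈ C(I; H¹ × H¹)` solves, on the open interval `I ∋ 0`,
`i ∂ₜu + Δu + (|u|² + β|v|²) u = 0`, `i ∂ₜv + Δv + (|v|² + β|u|²) v = 0`, in the sense of
distributions in space, pointwise in time. Values outside `I` are irrelevant. -/
structure IsSolution (β : ℝ) (I : Set ℝ) (u v : ℝ → H1) : Prop where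
  isOpen : IsOpen I
  ordConnected : I.OrdConnected
  zero_mem : (0 : ℝ) ∈ I
  continuousOn_u : ContinuousOn u I
  continuousOn_v : ContinuousOn v I
  eq_u : ∀ φ : R3 → ℂ, IsTestFunction φ → ∀ t ∈ I,
    HasDerivAt (fun s => ∫ x, (u s).fn x * φ x)
      (Complex.I * (-dirichlet (u t) φ + ∫ x, nonlin β (u t) (v t) x * φ x)) t
  eq_v : ∀ φ : R3 → ℂ, IsTestFunction φ → ∀ t ∈ I,
    HasDerivAt (fun s => ∫ x, (v s).fn x * φ x)
      (Complex.I * (-dirichlet (v t) φ + ∫ x, nonlin β (v t) (u t) x * φ x)) t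

/-- `(u, v)` with lifespan `I` is the maximal `H¹`-solution: every solution with the same initial
data is a restriction of it. -/
def IsMaximalSolution (β : ℝ) (I : Set ℝ) (u v : ℝ → H1) : Prop :=
  IsSolution β I u v ∧
    ∀ (J : Set ℝ) (u' v' : ℝ → H1), IsSolution β J u' v' → u' 0 = u 0 → v' 0 = v 0 →
      J ⊆ I ∧ ∀ t ∈ J, u' t = u t ∧ v' t = v t

/-- The mixed norm `‖u‖_{L^q_I L^r_x}`. -/
def mixedNorm (q r : ℝ≥0∞) (I : Set ℝ) (u : ℝ → H1) : ℝ≥0∞ :=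
  eLpNorm (fun t => eLpNorm (u t).fn r volume) q (volume.restrict I)

/-- The norm `‖u‖_{S(Ḣ^{1/2}; I)}`: the supremum of `‖u‖_{L^q_I L^r_x}` over all
`Ḣ^{1/2}`-admissible pairs, `2/q + 3/r = 3/2 - 1/2 = 1`, with `3 ≤ r ≤ r₁`, where `r₁ = 6⁻` is a
fixed number below `6`. Here `1/∞ = 0`, and `r ≤ r₁ < 6` is the same as `4 < 2r₁/(r₁-3) ≤ q`. -/
def strichartzNorm (r₁ : ℝ) (I : Set ℝ) (u : ℝ → H1) : ℝ≥0∞ :=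
  ⨆ (q : ℝ≥0∞) (r : ℝ≥0∞) (_ : 2 / q + 3 / r = 1) (_ : 3 ≤ r) (_ : r ≤ ENNReal.ofReal r₁),
    mixedNorm q r I u

/-- The property `SC(u₀, v₀)`: the maximal solution with data `(u₀, v₀)` exists for all positive
times, and its `S(Ḣ^{1/2})`-norm is finite. -/
def SC (β r₁ : ℝ) (u₀ v₀ : H1) : Prop :=
  ∃ (I : Set ℝ) (u v : ℝ → H1), IsMaximalSolution β I u v ∧ u 0 = u₀ ∧ v 0 = v₀ ∧
    Ici 0 ⊆ I ∧ strichartzNorm r₁ I u + strichartzNorm r₁ I v < ⊤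

/-- `(P, Q)` is an `H¹` weak solution of
`-ΔP + P - (|P|² + β|Q|²) P = 0`, `-ΔQ + Q - (|Q|² + β|P|²) Q = 0`. -/
def IsEllipticSolution (β : ℝ) (P Q : H1) : Prop :=
  ∀ φ : R3 → ℂ, IsTestFunction φ →
    dirichlet P φ + (∫ x, P.fn x * φ x) - (∫ x, nonlin β P Q x * φ x) = 0 ∧
    dirichlet Q φ + (∫ x, Q.fn x * φ x) - (∫ x, nonlin β Q P x * φ x) = 0

/-- The Lagrangian (action) `J = E + ½ M` of the elliptic system. -/
def action (β : ℝ) (P Q : H1) : ℝ := energy β P Q + 1 / 2 * mass P Q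

/-- Ground state: a nontrivial solution of the elliptic system of least action among all
nontrivial solutions. -/
def IsGroundState (β : ℝ) (P Q : H1) : Prop :=
  IsEllipticSolution β P Q ∧ (P, Q) ≠ (0, 0) ∧
    ∀ P' Q' : H1, IsEllipticSolution β P' Q' → (P', Q') ≠ (0, 0) →
      action β P Q ≤ action β P' Q'

/-- The number `M_c` (in `[-∞, ∞]`): the supremum of all `δ` such that `SC(u₀, v₀)` holds for all
`H¹` data with `M(u₀,v₀) A(u₀,v₀) < M(P,Q) A(P,Q)` and `M(u₀,v₀) E(u₀,v₀) < δ`. -/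
def criticalLevel (β r₁ : ℝ) (P Q : H1) : EReal :=
  sSup (Real.toEReal '' {δ : ℝ | ∀ u₀ v₀ : H1,
    mass u₀ v₀ * gradSq u₀ v₀ < mass P Q * gradSq P Q →
    mass u₀ v₀ * energy β u₀ v₀ < δ → SC β r₁ u₀ v₀})

/-- `(u, v)` is a critical solution: a global `H¹` solution with `M(u,v) = 1`,
`E(u,v) = M_c < M(P,Q) E(P,Q)`, `M(u,v) A(u,v) < M(P,Q) A(P,Q)`, and infinite
`S(Ḣ^{1/2})`-norm. -/
structure IsCriticalSolution (β r₁ : ℝ) (P Q : H1) (u v : ℝ → H1) : Prop where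
  isSolution : IsSolution β univ u v
  mass_eq : ∀ t, mass (u t) (v t) = 1
  energy_eq : ∀ t, (energy β (u t) (v t) : EReal) = criticalLevel β r₁ P Q
  level_lt : criticalLevel β r₁ P Q < ((mass P Q * energy β P Q : ℝ) : EReal)
  gradSq_lt : ∀ t, mass (u t) (v t) * gradSq (u t) (v t) < mass P Q * gradSq P Q
  norm_eq_top : strichartzNorm r₁ univ u + strichartzNorm r₁ univ v = ⊤

end NLSSystem

end

noncomputable section

namespace NLSSystem

/-! ### The Sobolev space as a normed space -/

/-- The `L²` class underlying an element of `H¹`. -/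
def H1.fnL : H1 →L[ℂ] L2 :=
  (WithLp.fstL 2 ℂ L2 (PiLp 2 (fun _ : Fin 3 => L2))).comp sobolevGraph.subtypeL

/-- The `L²` class of the `j`-th weak partial derivative. -/
def H1.gradL (j : Fin 3) : H1 →L[ℂ] L2 :=
  (PiLp.proj 2 (fun _ : Fin 3 => L2) j).comp
    ((WithLp.sndL 2 ℂ L2 (PiLp 2 (fun _ : Fin 3 => L2))).comp sobolevGraph.subtypeL)

lemma H1.coe_fnL (f : H1) : (H1.fnL f : R3 → ℂ) = f.fn := rfl

lemma H1.coe_gradL (f : H1) (j : Fin 3) : (H1.gradL j f : R3 → ℂ) = f.grad j := rfl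

/-- The element of `H¹` with given function and weak gradient. -/
def H1.mk (f : L2) (g : Fin 3 → L2) (h : IsWeakGrad f g) : H1 :=
  ⟨WithLp.toLp 2 (f, WithLp.toLp 2 g), h⟩

@[simp] lemma H1.fnL_mk {f : L2} {g : Fin 3 → L2} (h : IsWeakGrad f g) :
    H1.fnL (H1.mk f g h) = f := rfl

@[simp] lemma H1.gradL_mk {f : L2} {g : Fin 3 → L2} (h : IsWeakGrad f g) (j : Fin 3) :
    H1.gradL j (H1.mk f g h) = g j := rfl

@[simp] lemma H1.fnL_translate (a : R3) (f : H1) :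
    H1.fnL (f.translate a) = translateL2 a (H1.fnL f) := rfl

@[simp] lemma H1.gradL_translate (a : R3) (f : H1) (j : Fin 3) :
    H1.gradL j (f.translate a) = translateL2 a (H1.gradL j f) := rfl

lemma H1.isWeakGrad (f : H1) : IsWeakGrad (H1.fnL f) (fun j => H1.gradL j f) := f.2

lemma H1.norm_sq (f : H1) : ‖f‖ ^ 2 = ‖H1.fnL f‖ ^ 2 + ∑ j, ‖H1.gradL j f‖ ^ 2 := by
  have h := WithLp.prod_norm_sq_eq_of_L2 (f : WithLp 2 (L2 × PiLp 2 (fun _ : Fin 3 => L2)))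
  rw [PiLp.norm_sq_eq_of_L2] at h
  exact h

lemma H1.norm_le (f : H1) : ‖f‖ ≤ ‖H1.fnL f‖ + ∑ j, ‖H1.gradL j f‖ := by
  have h0 : 0 ≤ ∑ j, ‖H1.gradL j f‖ := Finset.sum_nonneg fun _ _ => norm_nonneg _
  refine abs_le_of_sq_le_sq' ?_ (by positivity) |>.2
  rw [H1.norm_sq]
  have h1 : ∑ j, ‖H1.gradL j f‖ ^ 2 ≤ (∑ j, ‖H1.gradL j f‖) ^ 2 :=
    Finset.sum_sq_le_sq_sum_of_nonneg fun _ _ => norm_nonneg _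
  nlinarith [mul_nonneg (norm_nonneg (H1.fnL f)) h0]

lemma H1.norm_fnL_le (f : H1) : ‖H1.fnL f‖ ≤ ‖f‖ := by
  refine abs_le_of_sq_le_sq' ?_ (norm_nonneg _) |>.2
  rw [H1.norm_sq]
  exact le_add_of_nonneg_right (Finset.sum_nonneg fun _ _ => by positivity)

lemma H1.norm_gradL_le (f : H1) (j : Fin 3) : ‖H1.gradL j f‖ ≤ ‖f‖ := by
  refine abs_le_of_sq_le_sq' ?_ (norm_nonneg _) |>.2
  rw [H1.norm_sq]
  have := Finset.single_le_sum (f := fun j => ‖H1.gradL j f‖ ^ 2) (fun _ _ => by positivity)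
    (Finset.mem_univ j)
  nlinarith [sq_nonneg ‖H1.fnL f‖]

lemma H1.tendsto_of {α : Type*} {l : Filter α} {F : α → H1} {f : H1}
    (h0 : Tendsto (fun a => H1.fnL (F a)) l (𝓝 (H1.fnL f)))
    (h1 : ∀ j, Tendsto (fun a => H1.gradL j (F a)) l (𝓝 (H1.gradL j f))) :
    Tendsto F l (𝓝 f) := by
  rw [tendsto_iff_norm_sub_tendsto_zero]
  refine squeeze_zero (g := fun a => ‖H1.fnL (F a) - H1.fnL f‖
    + ∑ j, ‖H1.gradL j (F a) - H1.gradL j f‖) (fun _ => norm_nonneg _) (fun a => ?_) ?_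
  · have h := H1.norm_le (F a - f)
    rw [(H1.fnL).map_sub] at h
    simpa only [ContinuousLinearMap.map_sub] using h
  have e0 := tendsto_iff_norm_sub_tendsto_zero.1 h0
  have e1 : Tendsto (fun a => ∑ j, ‖H1.gradL j (F a) - H1.gradL j f‖) l (𝓝 (∑ _j : Fin 3, 0)) :=
    tendsto_finsetSum _ fun j _ => tendsto_iff_norm_sub_tendsto_zero.1 (h1 j)
  simpa using e0.add e1

lemma H1.continuous_of {α : Type*} [TopologicalSpace α] {F : α → H1}
    (h0 : Continuous fun a => H1.fnL (F a)) (h1 : ∀ j, Continuous fun a => H1.gradL j (F a)) :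
    Continuous F :=
  continuous_iff_continuousAt.2 fun _ =>
    H1.tendsto_of h0.continuousAt fun j => (h1 j).continuousAt

lemma H1.ext' {f g : H1} (h0 : H1.fnL f = H1.fnL g) (h1 : ∀ j, H1.gradL j f = H1.gradL j g) :
    f = g := by
  rw [← sub_eq_zero, ← norm_eq_zero, ← sq_eq_zero_iff, H1.norm_sq]
  simp [ContinuousLinearMap.map_sub, h0, h1]

/-! ### The bilinear pairing on `L²` -/

/-- The bilinear pairing `(f, g) ↦ ∫ f g` on `L²`. -/
def mulPair : L2 →L[ℂ] L2 →L[ℂ] ℂ := (ContinuousLinearMap.mul ℂ ℂ).lpPairing volume 2 2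

lemma mulPair_apply (f g : L2) : mulPair f g = ∫ x, f x * g x :=
  (ContinuousLinearMap.mul ℂ ℂ).lpPairing_eq_integral f g

lemma L2.norm_sq (f : L2) : ‖f‖ ^ 2 = ∫ x, ‖f x‖ ^ 2 := by
  have h := L2.inner_def (𝕜 := ℂ) f f
  simp only [inner_self_eq_norm_sq_to_K] at h
  have h2 : ∫ a, ((‖f a‖ : ℂ)) ^ 2 = ((∫ a, ‖f a‖ ^ 2 : ℝ) : ℂ) := by
    rw [← integral_complex_ofReal]; simp
  have h3 : ((‖f‖ ^ 2 : ℝ) : ℂ) = ((∫ a, ‖f a‖ ^ 2 : ℝ) : ℂ) := by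
    rw [← h2]; push_cast; exact h
  exact_mod_cast h3

lemma L2.integrable_norm_sq (f : L2) : Integrable fun x => ‖f x‖ ^ 2 :=
  (memLp_two_iff_integrable_sq_norm (Lp.aestronglyMeasurable f)).1 (Lp.memLp f)

lemma L2.integrable_mul (f g : L2) : Integrable fun x => f x * g x :=
  integrable_mul_L2 f (Lp.memLp g)

/-! ### Complex conjugation -/

/-- Complex conjugation on `L²`. -/
def conjL2 : L2 →L[ℝ] L2 := (Complex.conjCLE : ℂ →L[ℝ] ℂ).compLpL 2 volume

lemma coeFn_conjL2 (f : L2) : conjL2 f =ᵐ[volume] fun x => starRingEnd ℂ (f x) :=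
  (Complex.conjCLE : ℂ →L[ℝ] ℂ).coeFn_compLpL f

lemma pderiv_conj {φ : R3 → ℂ} (hφ : Differentiable ℝ φ) (j : Fin 3) (x : R3) :
    pderiv j (fun y => starRingEnd ℂ (φ y)) x = starRingEnd ℂ (pderiv j φ x) := by
  have := ((Complex.conjCLE : ℂ →L[ℝ] ℂ).hasFDerivAt.comp x (hφ x).hasFDerivAt).fderiv
  simp only [pderiv]
  have h2 : (fun y => starRingEnd ℂ (φ y)) = (Complex.conjCLE : ℂ →L[ℝ] ℂ) ∘ φ := rfl
  rw [h2, this]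
  rfl

lemma IsTestFunction.differentiable {φ : R3 → ℂ} (h : IsTestFunction φ) : Differentiable ℝ φ :=
  h.1.differentiable (by simp)

lemma IsTestFunction.conj {φ : R3 → ℂ} (h : IsTestFunction φ) :
    IsTestFunction (fun y => starRingEnd ℂ (φ y)) :=
  ⟨(Complex.conjCLE : ℂ →L[ℝ] ℂ).contDiff.comp h.1, h.2.comp_left (by simp)⟩

lemma integral_conjL2_mul (f : L2) (φ : R3 → ℂ) :
    ∫ x, conjL2 f x * φ x = starRingEnd ℂ (∫ x, f x * starRingEnd ℂ (φ x)) := by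
  rw [← integral_conj]
  refine integral_congr_ae ?_
  filter_upwards [coeFn_conjL2 f] with x hx
  rw [hx]; simp

lemma IsWeakGrad.conj {f : L2} {g : Fin 3 → L2} (h : IsWeakGrad f g) :
    IsWeakGrad (conjL2 f) (fun j => conjL2 (g j)) := by
  intro φ hφ j
  rw [integral_conjL2_mul, integral_conjL2_mul]
  simp only [← pderiv_conj hφ.differentiable]
  rw [h _ hφ.conj j, map_neg]

/-- Complex conjugation on `H¹`. -/
def H1.conj (f : H1) : H1 := H1.mk _ _ f.isWeakGrad.conj

@[simp] lemma H1.fnL_conj (f : H1) : H1.fnL f.conj = conjL2 (H1.fnL f) := rfl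

@[simp] lemma H1.gradL_conj (f : H1) (j : Fin 3) :
    H1.gradL j f.conj = conjL2 (H1.gradL j f) := rfl

lemma H1.continuous_conj : Continuous H1.conj := by
  refine H1.continuous_of ?_ fun j => ?_
  · exact conjL2.continuous.comp H1.fnL.continuous
  · exact conjL2.continuous.comp (H1.gradL j).continuous

/-! ### Multiplication by bounded smooth functions -/

/-- Smooth functions which are bounded together with their first derivatives. -/
structure IsMultiplier (m : R3 → ℂ) : Prop where
  contDiff : ContDiff ℝ ∞ m
  memLp : MemLp m ∞ (volume : Measure R3)
  memLp_pderiv : ∀ j, MemLp (pderiv j m) ∞ (volume : Measure R3)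

lemma IsMultiplier.differentiable {m : R3 → ℂ} (h : IsMultiplier m) : Differentiable ℝ m :=
  h.contDiff.differentiable (by simp)

lemma continuous_pderiv {m : R3 → ℂ} (h : ContDiff ℝ ∞ m) (j : Fin 3) :
    Continuous (pderiv j m) :=
  (h.continuous_fderiv (by simp)).clm_apply continuous_const

lemma contDiff_pderiv {m : R3 → ℂ} (h : ContDiff ℝ ∞ m) (j : Fin 3) :
    ContDiff ℝ ∞ (pderiv j m) :=
  (h.fderiv_right (m := ∞) (by simp)).clm_apply contDiff_const

lemma IsMultiplier.of_bound {m : R3 → ℂ} (h : ContDiff ℝ ∞ m) {C D : ℝ} (hC : ∀ x, ‖m x‖ ≤ C)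
    (hD : ∀ j x, ‖pderiv j m x‖ ≤ D) : IsMultiplier m :=
  ⟨h, memLp_top_of_bound h.continuous.aestronglyMeasurable C (Eventually.of_forall hC),
    fun j => memLp_top_of_bound (continuous_pderiv h j).aestronglyMeasurable D
      (Eventually.of_forall (hD j))⟩

lemma IsTestFunction.pderiv {φ : R3 → ℂ} (h : IsTestFunction φ) (j : Fin 3) :
    IsTestFunction (pderiv j φ) :=
  ⟨contDiff_pderiv h.1 j, (h.2.fderiv (𝕜 := ℝ)).comp_left
    (g := fun L : R3 →L[ℝ] ℂ => L (EuclideanSpace.single j 1)) (by simp)⟩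

lemma IsTestFunction.isMultiplier {φ : R3 → ℂ} (h : IsTestFunction φ) : IsMultiplier φ :=
  ⟨h.1, h.1.continuous.memLp_top_of_hasCompactSupport h.2 _, fun j =>
    (h.pderiv j).1.continuous.memLp_top_of_hasCompactSupport (h.pderiv j).2 _⟩

/-- Multiplication of an `L²` function by a bounded function. -/
def mulL2 (m : R3 → ℂ) (hm : MemLp m ∞ (volume : Measure R3)) : L2 →L[ℂ] L2 :=
  (ContinuousLinearMap.mul ℂ ℂ).holderL volume ∞ 2 2 (hm.toLp m)

lemma coeFn_mulL2 {m : R3 → ℂ} (hm : MemLp m ∞ (volume : Measure R3)) (f : L2) :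
    mulL2 m hm f =ᵐ[volume] fun x => m x * f x := by
  have h := (ContinuousLinearMap.mul ℂ ℂ).coeFn_holder (r := 2) (hm.toLp m) f
  filter_upwards [h, hm.coeFn_toLp] with x h1 h2
  rw [mulL2, ContinuousLinearMap.holderL_apply_apply, h1, h2]
  rfl

lemma integral_mulL2_mul {m : R3 → ℂ} (hm : MemLp m ∞ (volume : Measure R3)) (f : L2)
    (φ : R3 → ℂ) : ∫ x, mulL2 m hm f x * φ x = ∫ x, f x * (m x * φ x) := by
  refine integral_congr_ae ?_
  filter_upwards [coeFn_mulL2 hm f] with x hx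
  rw [hx]; ring

lemma pderiv_mul {m φ : R3 → ℂ} (hm : Differentiable ℝ m) (hφ : Differentiable ℝ φ) (j : Fin 3)
    (x : R3) : pderiv j (fun y => m y * φ y) x = m x * pderiv j φ x + pderiv j m x * φ x := by
  have := ((hm x).hasFDerivAt.mul (hφ x).hasFDerivAt).fderiv
  simp only [pderiv]
  change (fderiv ℝ (m * φ) x) _ = _
  rw [this]
  simp [mul_comm]

lemma IsTestFunction.mul_left {φ m : R3 → ℂ} (hφ : IsTestFunction φ) (hm : ContDiff ℝ ∞ m) :
    IsTestFunction (fun x => m x * φ x) :=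
  ⟨hm.mul hφ.1, hφ.2.mul_left⟩

lemma IsWeakGrad.mul {f : L2} {g : Fin 3 → L2} (h : IsWeakGrad f g) {m : R3 → ℂ}
    (hm : IsMultiplier m) :
    IsWeakGrad (mulL2 m hm.memLp f)
      (fun j => mulL2 m hm.memLp (g j) + mulL2 (pderiv j m) (hm.memLp_pderiv j) f) := by
  intro φ hφ j
  have e : ∫ x, (mulL2 m hm.memLp (g j) + mulL2 (pderiv j m) (hm.memLp_pderiv j) f : L2) x * φ x
      = (∫ x, g j x * (m x * φ x)) + ∫ x, f x * (pderiv j m x * φ x) := by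
    rw [← integral_mulL2_mul hm.memLp, ← integral_mulL2_mul (hm.memLp_pderiv j),
      ← integral_add (integrable_mul_L2 _ hφ.memLp) (integrable_mul_L2 _ hφ.memLp)]
    refine integral_congr_ae ?_
    filter_upwards [Lp.coeFn_add (mulL2 m hm.memLp (g j))
      (mulL2 (NLSSystem.pderiv j m) (hm.memLp_pderiv j) f)] with x hx
    rw [hx, Pi.add_apply, add_mul]
  have h1 := h _ (hφ.mul_left hm.contDiff) j
  have h2 : ∫ x, f x * pderiv j (fun y => m y * φ y) x
      = (∫ x, f x * (m x * pderiv j φ x)) + ∫ x, f x * (pderiv j m x * φ x) := by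
    rw [← integral_add (integrable_mul_L2 f ((hφ.pderiv j).mul_left hm.contDiff).memLp)
      (integrable_mul_L2 f (hφ.mul_left (contDiff_pderiv hm.contDiff j)).memLp)]
    refine integral_congr_ae (Eventually.of_forall fun x => ?_)
    simp only [pderiv_mul hm.differentiable hφ.differentiable, mul_add]
  rw [integral_mulL2_mul, e]
  linear_combination h1 - h2

/-- Multiplication of an `H¹` function by a bounded smooth function. -/
def H1.mul (m : R3 → ℂ) (hm : IsMultiplier m) (f : H1) : H1 := H1.mk _ _ (f.isWeakGrad.mul hm)

@[simp] lemma H1.fnL_mul {m : R3 → ℂ} (hm : IsMultiplier m) (f : H1) :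
    H1.fnL (f.mul m hm) = mulL2 m hm.memLp (H1.fnL f) := rfl

@[simp] lemma H1.gradL_mul {m : R3 → ℂ} (hm : IsMultiplier m) (f : H1) (j : Fin 3) :
    H1.gradL j (f.mul m hm) = mulL2 m hm.memLp (H1.gradL j f)
      + mulL2 (pderiv j m) (hm.memLp_pderiv j) (H1.fnL f) := rfl

lemma H1.continuous_mul {m : R3 → ℂ} (hm : IsMultiplier m) : Continuous (H1.mul m hm) := by
  refine H1.continuous_of ?_ fun j => ?_
  · exact (mulL2 m hm.memLp).continuous.comp H1.fnL.continuous
  · exact ((mulL2 m hm.memLp).continuous.comp (H1.gradL j).continuous).add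
      ((mulL2 _ (hm.memLp_pderiv j)).continuous.comp H1.fnL.continuous)

/-! ### Translations -/

lemma continuous_translateL2 : Continuous fun p : R3 × L2 => translateL2 p.1 p.2 := by
  have hc : Continuous fun p : R3 × L2 => (⟨fun x => x - p.1, by fun_prop⟩ : C(R3, R3)) :=
    ContinuousMap.continuous_of_continuous_uncurry _
      (show Continuous fun q : (R3 × L2) × R3 => q.2 - q.1.1 by fun_prop)
  exact Continuous.compMeasurePreservingLp continuous_snd hc
    (fun p => measurePreserving_sub_right volume p.1) (by simp)

lemma H1.continuous_translate : Continuous fun p : R3 × H1 => p.2.translate p.1 := by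
  refine H1.continuous_of ?_ fun j => ?_
  · exact continuous_translateL2.comp
      (continuous_fst.prodMk (H1.fnL.continuous.comp continuous_snd))
  · exact continuous_translateL2.comp
      (continuous_fst.prodMk ((H1.gradL j).continuous.comp continuous_snd))

/-! ### Test functions as elements of `H¹` -/

lemma IsTestFunction.isWeakGrad {φ : R3 → ℂ} (h : IsTestFunction φ) :
    IsWeakGrad (h.memLp.toLp φ) (fun j => (h.memLp_pderiv j).toLp (NLSSystem.pderiv j φ)) := by
  intro χ hχ j
  have e1 : ∫ x, h.memLp.toLp φ x * NLSSystem.pderiv j χ x = ∫ x, φ x * NLSSystem.pderiv j χ x := by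
    refine integral_congr_ae ?_
    filter_upwards [h.memLp.coeFn_toLp] with x hx
    rw [hx]
  have e2 : ∫ x, (h.memLp_pderiv j).toLp (NLSSystem.pderiv j φ) x * χ x = ∫ x, NLSSystem.pderiv j φ x * χ x := by
    refine integral_congr_ae ?_
    filter_upwards [(h.memLp_pderiv j).coeFn_toLp] with x hx
    rw [hx]
  rw [e1, e2]
  exact integral_mul_fderiv_eq_neg_fderiv_mul_of_integrable
    ((h.memLp_pderiv j).integrable_mul hχ.memLp) (h.memLp.integrable_mul (hχ.memLp_pderiv j))
    (h.memLp.integrable_mul hχ.memLp) (fun x _ => h.differentiable x)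
    (fun x _ => hχ.differentiable x)

/-- A test function as an element of `H¹`. -/
def IsTestFunction.toH1 {φ : R3 → ℂ} (h : IsTestFunction φ) : H1 := H1.mk _ _ h.isWeakGrad

lemma IsTestFunction.fn_toH1 {φ : R3 → ℂ} (h : IsTestFunction φ) : h.toH1.fn =ᵐ[volume] φ :=
  h.memLp.coeFn_toLp

lemma IsTestFunction.grad_toH1 {φ : R3 → ℂ} (h : IsTestFunction φ) (j : Fin 3) :
    h.toH1.grad j =ᵐ[volume] NLSSystem.pderiv j φ :=
  (h.memLp_pderiv j).coeFn_toLp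

/-! ### Density of test functions in `H¹` -/

lemma L2.tendsto_tail (f : L2) :
    Tendsto (fun R : ℝ => ∫ x in {x : R3 | R < ‖x‖}, ‖f x‖ ^ 2) atTop (𝓝 0) := by
  have hm : ∀ R : ℝ, MeasurableSet {x : R3 | R < ‖x‖} := fun R =>
    measurableSet_lt measurable_const measurable_norm
  simp_rw [← fun R => integral_indicator (μ := volume) (f := fun x => ‖f x‖ ^ 2) (hm R)]
  have := tendsto_integral_filter_of_dominated_convergence (μ := (volume : Measure R3))
    (l := (atTop : Filter ℝ))
    (F := fun R : ℝ => ({x : R3 | R < ‖x‖}).indicator fun x => ‖f x‖ ^ 2) (f := fun _ => 0)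
    (fun x => ‖f x‖ ^ 2)
    (Eventually.of_forall fun R => ((L2.integrable_norm_sq f).indicator (hm R)).1)
    (Eventually.of_forall fun R => Eventually.of_forall fun x => by
      rw [Set.indicator_apply]
      split_ifs <;> simp) (L2.integrable_norm_sq f)
    (Eventually.of_forall fun x => tendsto_const_nhds.congr' (by
      filter_upwards [eventually_ge_atTop ‖x‖] with R hR
      rw [Set.indicator_of_notMem]
      simpa using hR))
  simpa using this

lemma norm_mulL2_le {m : R3 → ℂ} (hm : MemLp m ∞ (volume : Measure R3)) {C : ℝ}
    (hC : ∀ x, ‖m x‖ ≤ C) (f : L2) : ‖mulL2 m hm f‖ ≤ C * ‖f‖ := by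
  refine Lp.norm_le_mul_norm_of_ae_le_mul ?_
  filter_upwards [coeFn_mulL2 hm f] with x hx
  rw [hx, norm_mul]
  exact mul_le_mul_of_nonneg_right (hC x) (norm_nonneg _)

/-- A fixed smooth cutoff function at unit scale. -/
def unitBump : ContDiffBump (0 : R3) := ⟨1, 2, one_pos, one_lt_two⟩

/-- Smooth cutoff function at scale `R`. -/
def cutoff (R : ℝ) (x : R3) : ℂ := (unitBump (R⁻¹ • x) : ℂ)

lemma isTestFunction_unitBump : IsTestFunction fun x => (unitBump x : ℂ) :=
  ⟨Complex.ofRealCLM.contDiff.comp unitBump.contDiff,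
    unitBump.hasCompactSupport.comp_left (g := ((↑) : ℝ → ℂ)) (by simp)⟩

lemma isTestFunction_cutoff {R : ℝ} (hR : 0 < R) : IsTestFunction (cutoff R) :=
  ⟨isTestFunction_unitBump.1.comp (contDiff_const_smul _),
    isTestFunction_unitBump.2.comp_homeomorph (Homeomorph.smulOfNeZero R⁻¹ (by positivity))⟩

lemma cutoff_eq_one {R : ℝ} (hR : 0 < R) {x : R3} (hx : ‖x‖ ≤ R) : cutoff R x = 1 := by
  have : unitBump (R⁻¹ • x) = 1 := by
    refine unitBump.one_of_mem_closedBall ?_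
    rw [mem_closedBall_zero_iff, norm_smul, norm_inv, Real.norm_of_nonneg hR.le]
    exact (inv_mul_le_one₀ hR).2 hx
  simp [cutoff, this]

lemma norm_cutoff_sub_one_le (R : ℝ) (x : R3) : ‖cutoff R x - 1‖ ≤ 1 := by
  have h : cutoff R x - 1 = ((unitBump (R⁻¹ • x) - 1 : ℝ) : ℂ) := by simp [cutoff]
  rw [h, Complex.norm_real, Real.norm_eq_abs, abs_le]
  constructor <;> linarith [unitBump.nonneg (x := R⁻¹ • x), unitBump.le_one (x := R⁻¹ • x)]

lemma pderiv_cutoff (R : ℝ) (j : Fin 3) (x : R3) :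
    pderiv j (cutoff R) x = (R⁻¹ : ℝ) • pderiv j (fun x => (unitBump x : ℂ)) (R⁻¹ • x) := by
  have h := (isTestFunction_unitBump.differentiable (R⁻¹ • x)).hasFDerivAt.comp x
    ((hasFDerivAt_id x).const_smul R⁻¹)
  have h2 : cutoff R = (fun x => (unitBump x : ℂ)) ∘ (HSMul.hSMul R⁻¹) := rfl
  simp only [pderiv]
  rw [h2, h.fderiv]
  simp

lemma exists_pderiv_cutoff_bound : ∃ D : ℝ, 0 ≤ D ∧ ∀ R : ℝ, 0 < R → ∀ j x,
    ‖pderiv j (cutoff R) x‖ ≤ D / R := by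
  have h : ∀ j, ∃ D, ∀ x, ‖pderiv j (fun x => (unitBump x : ℂ)) x‖ ≤ D := fun j =>
    (isTestFunction_unitBump.pderiv j).2.exists_bound_of_continuous
      (isTestFunction_unitBump.pderiv j).1.continuous
  choose D hD using h
  have hD0 : ∀ j, 0 ≤ D j := fun j => (norm_nonneg _).trans (hD j 0)
  refine ⟨∑ j, D j, Finset.sum_nonneg fun j _ => hD0 j, fun R hR j x => ?_⟩
  rw [pderiv_cutoff, norm_smul, norm_inv, Real.norm_of_nonneg hR.le, inv_mul_eq_div]
  gcongr
  exact (hD j _).trans (Finset.single_le_sum (fun j _ => hD0 j) (Finset.mem_univ j))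

lemma tendsto_mulL2_cutoff (f : L2) :
    Tendsto (fun n : ℕ => mulL2 (cutoff (n + 1))
      (isTestFunction_cutoff (by positivity : (0 : ℝ) < n + 1)).isMultiplier.memLp f)
      atTop (𝓝 f) := by
  rw [tendsto_iff_norm_sub_tendsto_zero]
  have h1 : Tendsto (fun n : ℕ => Real.sqrt
      (∫ x in {x : R3 | (n : ℝ) + 1 < ‖x‖}, ‖f x‖ ^ 2)) atTop (𝓝 0) := by
    have := ((L2.tendsto_tail f).comp
      (tendsto_atTop_add_const_right _ (1 : ℝ) tendsto_natCast_atTop_atTop)).sqrt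
    simpa [Function.comp_def] using this
  refine squeeze_zero (fun _ => norm_nonneg _) (fun n => Real.le_sqrt_of_sq_le ?_) h1
  have hR : (0 : ℝ) < n + 1 := by positivity
  have hm : MeasurableSet {x : R3 | (n : ℝ) + 1 < ‖x‖} :=
    measurableSet_lt measurable_const measurable_norm
  rw [L2.norm_sq, ← integral_indicator hm]
  refine integral_mono_ae (L2.integrable_norm_sq _) ((L2.integrable_norm_sq f).indicator hm) ?_
  filter_upwards [Lp.coeFn_sub (mulL2 (cutoff (n + 1))
    (isTestFunction_cutoff hR).isMultiplier.memLp f) f,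
    coeFn_mulL2 (isTestFunction_cutoff hR).isMultiplier.memLp f] with x h1 h2
  rw [h1, Pi.sub_apply, h2, Set.indicator_apply]
  split_ifs with hx
  · rw [← sub_one_mul, norm_mul, mul_pow]
    exact mul_le_of_le_one_left (by positivity)
      (pow_le_one₀ (norm_nonneg _) (norm_cutoff_sub_one_le _ _))
  · rw [cutoff_eq_one hR (by simpa using hx)]
    simp

lemma H1.tendsto_mul_cutoff (f : H1) :
    Tendsto (fun n : ℕ => f.mul (cutoff (n + 1))
      (isTestFunction_cutoff (by positivity : (0 : ℝ) < n + 1)).isMultiplier) atTop (𝓝 f) := by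
  refine H1.tendsto_of (tendsto_mulL2_cutoff _) fun j => ?_
  have h1 := tendsto_mulL2_cutoff (H1.gradL j f)
  have h2 : Tendsto (fun n : ℕ => mulL2 (pderiv j (cutoff (n + 1)))
      ((isTestFunction_cutoff (by positivity : (0 : ℝ) < n + 1)).isMultiplier.memLp_pderiv j)
      (H1.fnL f)) atTop (𝓝 0) := by
    obtain ⟨D, hD0, hD⟩ := exists_pderiv_cutoff_bound
    rw [tendsto_zero_iff_norm_tendsto_zero]
    refine squeeze_zero (g := fun n : ℕ => D * ‖H1.fnL f‖ * (1 / ((n : ℝ) + 1)))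
      (fun _ => norm_nonneg _) (fun n => ?_) ?_
    · refine (norm_mulL2_le _ (hD (n + 1) (by positivity) j) _).trans (le_of_eq ?_)
      ring
    · simpa using (tendsto_one_div_add_atTop_nhds_zero_nat (𝕜 := ℝ)).const_mul (D * ‖H1.fnL f‖)
  have h3 := h1.add h2
  rw [add_zero] at h3
  exact h3

lemma eLpNorm_mollify_sub_le (h : L2) {φ : R3 → ℝ} (hφc : Continuous φ)
    (hφs : HasCompactSupport φ) (hφ0 : ∀ a, 0 ≤ φ a) (hφ1 : ∫ a, φ a = 1) {δ : ℝ}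
    (hδ : ∀ a, φ a ≠ 0 → ‖translateL2 a h - h‖ ≤ δ) :
    eLpNorm (fun x => (∫ y, h y * (φ (x - y) : ℂ)) - h x) 2 volume ≤ ENNReal.ofReal δ := by
  have hh : Measurable h := (Lp.stronglyMeasurable h).measurable
  set μ : Measure R3 := volume.withDensity fun a => ENNReal.ofReal (φ a) with hμ
  have hφm : Measurable fun a => ENNReal.ofReal (φ a) := hφc.measurable.ennreal_ofReal
  have hprob : IsProbabilityMeasure μ := ⟨by
    rw [hμ, withDensity_apply _ MeasurableSet.univ, Measure.restrict_univ,
      ← ofReal_integral_eq_lintegral_ofReal (hφc.integrable_of_hasCompactSupport hφs)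
        (Eventually.of_forall hφ0), hφ1, ENNReal.ofReal_one]⟩
  have hpt : ∀ x, ‖(∫ y, h y * (φ (x - y) : ℂ)) - h x‖ₑ ^ 2 ≤
      ∫⁻ a, ‖h (x - a) - h x‖ₑ ^ 2 ∂μ := by
    intro x
    have hi : Integrable fun a => h (x - a) * (φ a : ℂ) := by
      have h1 : MemLp (fun a => h (x - a)) 2 (volume : Measure R3) :=
        (Lp.memLp h).comp_measurePreserving (Measure.measurePreserving_sub_left volume x)
      refine h1.integrable_mul (q := 2) ?_
      exact (Complex.continuous_ofReal.comp hφc).memLp_of_hasCompactSupport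
        (hφs.comp_left (g := ((↑) : ℝ → ℂ)) (by simp))
    have hi2 : Integrable fun a => h x * (φ a : ℂ) :=
      ((hφc.integrable_of_hasCompactSupport hφs).ofReal).const_mul _
    have e : (∫ y, h y * (φ (x - y) : ℂ)) - h x = ∫ a, (h (x - a) - h x) ∂μ := by
      rw [hμ, integral_withDensity_eq_integral_toReal_smul hφm (by simp)]
      simp only [ENNReal.toReal_ofReal (hφ0 _), Complex.real_smul]
      have e1 : ∫ y, h y * (φ (x - y) : ℂ) = ∫ a, h (x - a) * (φ a : ℂ) := by
        rw [← integral_sub_left_eq_self (fun y => h y * (φ (x - y) : ℂ)) volume x]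
        simp
      have e2 : ∫ a, h x * (φ a : ℂ) = h x := by
        rw [integral_const_mul, integral_complex_ofReal, hφ1]; simp
      have e3 := integral_sub hi hi2
      rw [e2] at e3
      rw [e1, ← e3]
      refine integral_congr_ae (Eventually.of_forall fun a => ?_)
      simp only []
      ring
    rw [e]
    have h1 : ‖∫ a, (h (x - a) - h x) ∂μ‖ₑ ≤ eLpNorm (fun a => h (x - a) - h x) 2 μ := by
      refine (enorm_integral_le_lintegral_enorm _).trans ?_
      rw [← eLpNorm_one_eq_lintegral_enorm]
      refine eLpNorm_le_eLpNorm_of_exponent_le (by norm_num) ?_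
      exact ((hh.comp (measurable_const.sub measurable_id)).sub_const _).aestronglyMeasurable
    refine (pow_le_pow_left' h1 2).trans (le_of_eq ?_)
    have := eLpNorm_nnreal_pow_eq_lintegral (μ := μ) (f := fun a => h (x - a) - h x) (p := 2)
      (by norm_num)
    norm_num at this
    exact_mod_cast this
  have hsq : eLpNorm (fun x => (∫ y, h y * (φ (x - y) : ℂ)) - h x) 2 volume ^ 2 ≤
      ENNReal.ofReal δ ^ 2 := by
    have e := eLpNorm_nnreal_pow_eq_lintegral (μ := (volume : Measure R3))
      (f := fun x => (∫ y, h y * (φ (x - y) : ℂ)) - h x) (p := 2) (by norm_num)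
    norm_num at e
    rw [e]
    refine (lintegral_mono hpt).trans ?_
    have hmeas : Measurable fun p : R3 × R3 => ‖h (p.1 - p.2) - h p.1‖ₑ ^ 2 :=
      (((hh.comp (measurable_fst.sub measurable_snd)).sub
        (hh.comp measurable_fst)).enorm.pow_const 2)
    rw [lintegral_lintegral_swap (f := fun x a => ‖h (x - a) - h x‖ₑ ^ 2) hmeas.aemeasurable]
    have hae : ∀ᵐ a ∂μ, ∫⁻ x, ‖h (x - a) - h x‖ₑ ^ 2 ≤ ENNReal.ofReal δ ^ 2 := by
      rw [hμ, ae_withDensity_iff hφm]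
      refine Eventually.of_forall fun a ha => ?_
      have ha' : φ a ≠ 0 := fun h0 => ha (by rw [h0, ENNReal.ofReal_zero])
      have h2 : eLpNorm (fun x => h (x - a) - h x) 2 volume ≤ ENNReal.ofReal δ := by
        have e3 : eLpNorm (fun x => h (x - a) - h x) 2 volume = ‖translateL2 a h - h‖ₑ := by
          rw [Lp.enorm_def]
          refine eLpNorm_congr_ae ?_
          filter_upwards [Lp.coeFn_sub (translateL2 a h) h, coeFn_translateL2 a h] with x hx hx'
          rw [hx, Pi.sub_apply, hx']
        rw [e3, ← ofReal_norm]
        exact ENNReal.ofReal_le_ofReal (hδ a ha')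
      have e4 := eLpNorm_nnreal_pow_eq_lintegral (μ := (volume : Measure R3))
        (f := fun x => h (x - a) - h x) (p := 2) (by norm_num)
      norm_num at e4
      rw [← e4]
      exact pow_le_pow_left' h2 2
    refine (lintegral_mono_ae hae).trans ?_
    simp
  exact (ENNReal.pow_le_pow_left_iff (by norm_num)).1 hsq

/-- The mollification of `f` by `φ`. -/
def mollify (φ : R3 → ℝ) (f : R3 → ℂ) (x : R3) : ℂ := ∫ y, f y * (φ (x - y) : ℂ)

lemma mollify_congr (φ : R3 → ℝ) {f f' : R3 → ℂ} (h : f =ᵐ[volume] f') :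
    mollify φ f = mollify φ f' := by
  ext x
  refine integral_congr_ae ?_
  filter_upwards [h] with y hy
  rw [hy]

lemma mollify_eq_convolution (φ : R3 → ℝ) (f : R3 → ℂ) :
    mollify φ f = convolution f (fun y => (φ y : ℂ)) (ContinuousLinearMap.mul ℝ ℂ) volume := rfl

lemma isTestFunction_mollify {φ : R3 → ℝ} (hφc : ContDiff ℝ ∞ φ) (hφs : HasCompactSupport φ)
    (f : L2) {R : ℝ} (hf : ∀ᵐ x, R ≤ ‖x‖ → f x = 0) : IsTestFunction (mollify φ f) := by
  have hs : HasCompactSupport (fun y => (φ y : ℂ)) :=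
    hφs.comp_left (g := ((↑) : ℝ → ℂ)) (by simp)
  constructor
  · rw [mollify_eq_convolution]
    exact hs.contDiff_convolution_right (n := ⊤) _ ((Lp.memLp f).locallyIntegrable (by norm_num))
      (Complex.ofRealCLM.contDiff.comp hφc)
  · have e : f =ᵐ[volume] (Metric.ball (0 : R3) R).indicator f := by
      filter_upwards [hf] with x hx
      by_cases h : x ∈ Metric.ball (0 : R3) R
      · rw [Set.indicator_of_mem h]
      · rw [Set.indicator_of_notMem h]
        exact hx (by simpa using h)
    rw [mollify_congr φ e, mollify_eq_convolution]
    refine HasCompactSupport.convolution _ ?_ hs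
    refine HasCompactSupport.intro (isCompact_closedBall (0 : R3) R) fun x hx => ?_
    rw [Set.indicator_of_notMem]
    exact fun h => hx (Metric.ball_subset_closedBall h)

lemma pderiv_mollify {φ : R3 → ℝ} (hφc : ContDiff ℝ ∞ φ) (hφs : HasCompactSupport φ)
    {f : L2} {g : Fin 3 → L2} (h : IsWeakGrad f g) (j : Fin 3) (x : R3) :
    pderiv j (mollify φ f) x = mollify φ (g j) x := by
  have hs : HasCompactSupport (fun y => (φ y : ℂ)) :=
    hφs.comp_left (g := ((↑) : ℝ → ℂ)) (by simp)
  have hc : ContDiff ℝ ∞ (fun y => (φ y : ℂ)) := Complex.ofRealCLM.contDiff.comp hφc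
  have hφ : IsTestFunction (fun y => (φ y : ℂ)) := ⟨hc, hs⟩
  have hli : LocallyIntegrable f volume := (Lp.memLp f).locallyIntegrable (by norm_num)
  have h1 := hs.hasFDerivAt_convolution_right (μ := (volume : Measure R3))
    (ContinuousLinearMap.mul ℝ ℂ) hli (hc.of_le (by simp)) x
  have hsub : IsTestFunction (fun y => (φ (x - y) : ℂ)) :=
    ⟨hc.comp (contDiff_const.sub contDiff_id), hs.comp_homeomorph (Homeomorph.subLeft x)⟩
  have h2 : ∀ y, pderiv j (fun y => (φ (x - y) : ℂ)) y
      = -pderiv j (fun y => (φ y : ℂ)) (x - y) := by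
    intro y
    have := ((hφ.differentiable (x - y)).hasFDerivAt.comp y
      ((hasFDerivAt_id y).const_sub x)).fderiv
    simp only [pderiv]
    change (fderiv ℝ ((fun y => (φ y : ℂ)) ∘ fun y => x - y) y) _ = _
    erw [this]
    simp
  have h3 := h _ hsub j
  simp only [h2, mul_neg, integral_neg, neg_inj] at h3
  rw [mollify, ← h3, pderiv, mollify_eq_convolution, h1.fderiv, convolution]
  rw [ContinuousLinearMap.integral_apply]
  · rfl
  · have := (hs.fderiv (𝕜 := ℝ)).convolutionExists_right
      ((ContinuousLinearMap.mul ℝ ℂ).precompR R3) hli (hc.continuous_fderiv (by simp)) x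
    exact this

/-- Test functions are dense in `H¹`. -/
theorem dense_testFunctions :
    Dense {f : H1 | ∃ (φ : R3 → ℂ) (h : IsTestFunction φ), f = h.toH1} := by
  rw [Metric.dense_iff]
  intro f ε hε
  obtain ⟨n, hn⟩ := ((Metric.tendsto_nhds.1 f.tendsto_mul_cutoff) (ε / 2) (by positivity)).exists
  set g := f.mul (cutoff (n + 1))
      (isTestFunction_cutoff (by positivity : (0 : ℝ) < n + 1)).isMultiplier with hg
  have hT : Tendsto (fun a : R3 => g.translate a) (𝓝 0) (𝓝 (g.translate 0)) :=
    (H1.continuous_translate.comp (continuous_id.prodMk continuous_const)).tendsto 0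
  have hT0 : ∀ h : L2, translateL2 0 h = h := fun h => by
    refine Lp.ext ?_
    filter_upwards [coeFn_translateL2 0 h] with x hx
    simpa using hx
  have hT1 : g.translate 0 = g := H1.ext' (hT0 _) fun j => hT0 _
  rw [hT1] at hT
  obtain ⟨r, hr, hr'⟩ := Metric.eventually_nhds_iff_ball.1
    ((Metric.tendsto_nhds.1 hT) (ε / 10) (by positivity))
  set b : ContDiffBump (0 : R3) := ⟨r / 2, r, by positivity, by linarith⟩ with hb
  set φ : R3 → ℝ := b.normed volume with hφ
  have hφc : ContDiff ℝ ∞ φ := b.contDiff_normed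
  have hφs : HasCompactSupport φ := b.hasCompactSupport_normed
  have hφr : ∀ a, φ a ≠ 0 → ‖g.translate a - g‖ ≤ ε / 10 := by
    intro a ha
    have : a ∈ Metric.ball (0 : R3) r := by
      have h := b.support_normed_eq (μ := volume)
      have h2 : a ∈ Function.support (b.normed volume) := ha
      rwa [h] at h2
    have := hr' a this
    rw [dist_eq_norm] at this
    exact this.le
  have hconv : ∀ (L : H1 →L[ℂ] L2), (∀ a, L (g.translate a) = translateL2 a (L g)) →
      (∀ f, ‖L f‖ ≤ ‖f‖) →
      eLpNorm (fun x => mollify φ (L g) x - L g x) 2 volume ≤ ENNReal.ofReal (ε / 10) := by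
    intro L hL hL1
    refine eLpNorm_mollify_sub_le (L g) hφc.continuous hφs (fun a => b.nonneg_normed a)
      b.integral_normed fun a ha => ?_
    rw [← hL, ← L.map_sub]
    exact (hL1 _).trans (hφr a ha)
  obtain ⟨R, hR⟩ : ∃ R : ℝ, ∀ᵐ x, R ≤ ‖x‖ → H1.fnL g x = 0 := by
    obtain ⟨R, hR⟩ := (isTestFunction_cutoff
      (by positivity : (0 : ℝ) < n + 1)).2.isCompact.isBounded.subset_ball 0
    refine ⟨R, ?_⟩
    filter_upwards [coeFn_mulL2 (isTestFunction_cutoff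
      (by positivity : (0 : ℝ) < n + 1)).isMultiplier.memLp (H1.fnL f)] with x hx hx'
    have h0 : cutoff (n + 1) x = 0 := by
      by_contra h0
      have := hR (subset_tsupport _ h0)
      simp at this
      linarith
    rw [hg, H1.fnL_mul, hx, h0, zero_mul]
  have htest := isTestFunction_mollify hφc hφs _ hR
  have hnorm : ∀ (F : R3 → ℂ) (hF : MemLp F 2 (volume : Measure R3)) (h : L2),
      eLpNorm (fun x => F x - h x) 2 volume ≤ ENNReal.ofReal (ε / 10) →
      ‖hF.toLp F - h‖ ≤ ε / 10 := by
    intro F hF h hle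
    rw [Lp.norm_def]
    refine ENNReal.toReal_le_of_le_ofReal (by positivity) (le_trans (le_of_eq ?_) hle)
    refine eLpNorm_congr_ae ?_
    filter_upwards [Lp.coeFn_sub (hF.toLp F) h, hF.coeFn_toLp] with x h1 h2
    rw [h1, Pi.sub_apply, h2]
  have hfin : ‖htest.toH1 - g‖ ≤ 4 * (ε / 10) := by
    refine (H1.norm_le _).trans ?_
    have h1 : ‖H1.fnL (htest.toH1 - g)‖ ≤ ε / 10 := by
      rw [ContinuousLinearMap.map_sub]
      exact hnorm _ htest.memLp _ (hconv H1.fnL (fun _ => rfl) H1.norm_fnL_le)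
    have h2 : ∀ j, ‖H1.gradL j (htest.toH1 - g)‖ ≤ ε / 10 := by
      intro j
      rw [ContinuousLinearMap.map_sub]
      refine hnorm _ (htest.memLp_pderiv j) _ ?_
      simp only [pderiv_mollify hφc hφs g.isWeakGrad]
      exact hconv (H1.gradL j) (fun _ => rfl) fun f => f.norm_gradL_le j
    have h3 := Finset.sum_le_sum fun j (_ : j ∈ Finset.univ) => h2 j
    simp only [Finset.sum_const, Finset.card_univ, Fintype.card_fin, nsmul_eq_mul] at h3
    push_cast at h3
    linarith
  refine ⟨htest.toH1, ?_, _, htest, rfl⟩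
  rw [Metric.mem_ball, dist_eq_norm]
  rw [dist_eq_norm] at hn
  calc ‖htest.toH1 - f‖ ≤ ‖htest.toH1 - g‖ + ‖g - f‖ := norm_sub_le_norm_sub_add_norm_sub _ _ _
    _ < ε := by linarith

/-! ### Sobolev embedding -/

lemma norm_le_sum_single (L : R3 →L[ℝ] ℂ) : ‖L‖ ≤ ∑ j, ‖L (EuclideanSpace.single j 1)‖ := by
  refine L.opNorm_le_bound (Finset.sum_nonneg fun _ _ => norm_nonneg _) fun x => ?_
  have hx : x = ∑ j, x j • (EuclideanSpace.single j (1 : ℝ) : R3) := by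
    have := (EuclideanSpace.basisFun (Fin 3) ℝ).sum_repr x
    simpa using this.symm
  have h1 : L x = ∑ j, x j • L (EuclideanSpace.single j 1) := by
    nth_rewrite 1 [hx]
    simp [map_sum]
  rw [h1, Finset.sum_mul]
  refine (norm_sum_le _ _).trans (Finset.sum_le_sum fun j _ => ?_)
  rw [norm_smul, mul_comm]
  exact mul_le_mul_of_nonneg_left (PiLp.norm_apply_le x j) (norm_nonneg _)

lemma exists_sobolev_testFunction : ∃ K : ℝ, 0 ≤ K ∧ ∀ (φ : R3 → ℂ) (h : IsTestFunction φ),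
    eLpNorm φ 6 volume ≤ ENNReal.ofReal (K * ‖h.toH1‖) := by
  set C := SNormLESNormFDerivOfEqConst ℂ (volume : Measure R3) 2 with hC
  refine ⟨C * 3, by positivity, fun φ h => ?_⟩
  have h1 := eLpNorm_le_eLpNorm_fderiv_of_eq (volume : Measure R3) (u := φ)
    (h.1.of_le (by simp)) h.2 (p := 2) (p' := 6) (by norm_num) (by simp) (by simp; norm_num)
  have h2 : eLpNorm (fderiv ℝ φ) 2 volume ≤ ∑ j, eLpNorm (pderiv j φ) 2 volume := by
    calc eLpNorm (fderiv ℝ φ) 2 volume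
        ≤ eLpNorm (∑ j, fun x => ‖pderiv j φ x‖) 2 volume := by
          refine eLpNorm_mono_real fun x => ?_
          simpa [pderiv] using norm_le_sum_single (fderiv ℝ φ x)
      _ ≤ ∑ j, eLpNorm (fun x => ‖pderiv j φ x‖) 2 volume :=
          eLpNorm_sum_le (fun j _ => (h.memLp_pderiv j).1.norm) (by norm_num)
      _ = _ := by simp only [eLpNorm_norm]
  have h3 : ∀ j, eLpNorm (pderiv j φ) 2 volume ≤ ENNReal.ofReal ‖h.toH1‖ := by
    intro j
    refine le_trans (le_of_eq ?_) (ENNReal.ofReal_le_ofReal (h.toH1.norm_gradL_le j))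
    rw [ofReal_norm, Lp.enorm_def]
    exact (eLpNorm_congr_ae (h.grad_toH1 j)).symm
  have h4 : ∑ j : Fin 3, eLpNorm (pderiv j φ) 2 volume ≤ 3 * ENNReal.ofReal ‖h.toH1‖ := by
    refine (Finset.sum_le_sum fun j _ => h3 j).trans (le_of_eq ?_)
    simp
  have h5 : eLpNorm φ 6 volume ≤ C * (3 * ENNReal.ofReal ‖h.toH1‖) := by
    refine le_trans (by exact_mod_cast h1) ?_
    gcongr
    exact h2.trans h4
  refine h5.trans (le_of_eq ?_)
  rw [mul_assoc, ENNReal.ofReal_mul (by positivity), ENNReal.ofReal_mul (by norm_num)]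
  simp

lemma exists_sobolev_six : ∃ K : ℝ, 0 ≤ K ∧ ∀ f : H1,
    eLpNorm f.fn 6 volume ≤ ENNReal.ofReal (K * ‖f‖) := by
  obtain ⟨K, hK0, hK⟩ := exists_sobolev_testFunction
  refine ⟨K, hK0, fun f => ?_⟩
  obtain ⟨F, hF, hlim⟩ := mem_closure_iff_seq_limit.1 (dense_testFunctions f)
  have h1 : Tendsto (fun n => H1.fnL (F n)) atTop (𝓝 (H1.fnL f)) :=
    (H1.fnL.continuous.tendsto f).comp hlim
  obtain ⟨ns, hns, hae⟩ := (tendstoInMeasure_of_tendsto_Lp h1).exists_seq_tendsto_ae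
  have h2 := Lp.eLpNorm_lim_le_liminf_eLpNorm (p := 6)
    (fun n => Lp.aestronglyMeasurable (H1.fnL (F (ns n)))) (H1.fnL f) hae
  refine h2.trans ?_
  have h3 : ∀ n, eLpNorm (H1.fnL (F (ns n))) 6 volume ≤ ENNReal.ofReal (K * ‖F (ns n)‖) := by
    intro n
    obtain ⟨φ, hφ, e⟩ := hF (ns n)
    rw [e]
    exact (eLpNorm_congr_ae hφ.fn_toH1).le.trans (hK φ hφ)
  have h4 : Tendsto (fun n => ENNReal.ofReal (K * ‖F (ns n)‖)) atTop
      (𝓝 (ENNReal.ofReal (K * ‖f‖))) :=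
    ENNReal.tendsto_ofReal (((hlim.comp hns.tendsto_atTop).norm).const_mul K)
  rw [← h4.liminf_eq]
  exact liminf_le_liminf (Eventually.of_forall h3)

lemma exists_sobolev_four : ∃ K : ℝ, 0 ≤ K ∧ ∀ f : H1,
    eLpNorm f.fn 4 volume ≤ ENNReal.ofReal (K * ‖f‖) := by
  obtain ⟨K, hK0, hK⟩ := exists_sobolev_six
  refine ⟨1 + K, by positivity, fun f => ?_⟩
  have hm : AEMeasurable (fun x => ‖f.fn x‖ₑ) volume :=
    (Lp.aestronglyMeasurable (H1.fnL f)).enorm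
  have e4 := eLpNorm_nnreal_pow_eq_lintegral (μ := (volume : Measure R3)) (f := f.fn) (p := 4)
    (by norm_num)
  have e2 := eLpNorm_nnreal_pow_eq_lintegral (μ := (volume : Measure R3)) (f := f.fn) (p := 2)
    (by norm_num)
  have e6 := eLpNorm_nnreal_pow_eq_lintegral (μ := (volume : Measure R3)) (f := f.fn) (p := 6)
    (by norm_num)
  norm_num at e4 e2 e6
  have hH := ENNReal.lintegral_mul_le_Lp_mul_Lq volume Real.HolderConjugate.two_two hm
    (hm.pow_const 3)
  have hl : ∫⁻ x, ((fun x => ‖f.fn x‖ₑ) * fun x => ‖f.fn x‖ₑ ^ 3) x =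
      ∫⁻ x, ‖f.fn x‖ₑ ^ 4 := by
    refine lintegral_congr fun x => ?_
    simp only [Pi.mul_apply]; ring
  have h6 : ∫⁻ x, (‖f.fn x‖ₑ ^ 3) ^ (2 : ℝ) = eLpNorm f.fn 6 volume ^ 6 := by
    rw [show eLpNorm f.fn 6 volume ^ 6 = _ by exact_mod_cast e6]
    refine lintegral_congr fun x => ?_
    rw [show (2 : ℝ) = ((2 : ℕ) : ℝ) by norm_num, ENNReal.rpow_natCast, ← pow_mul]
  have h2 : ∫⁻ x, (‖f.fn x‖ₑ) ^ (2 : ℝ) = eLpNorm f.fn 2 volume ^ 2 := by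
    rw [show eLpNorm f.fn 2 volume ^ 2 = _ by exact_mod_cast e2]
    refine lintegral_congr fun x => ?_
    rw [show (2 : ℝ) = ((2 : ℕ) : ℝ) by norm_num, ENNReal.rpow_natCast]
  have hsq : ∀ (a : ℝ≥0∞), (a ^ 2) ^ (1 / 2 : ℝ) = a := by
    intro a
    rw [← ENNReal.rpow_natCast, ← ENNReal.rpow_mul]
    norm_num
  rw [hl, h6, h2, hsq, show eLpNorm f.fn 6 volume ^ 6 = (eLpNorm f.fn 6 volume ^ 3) ^ 2 by ring,
    hsq] at hH
  set X := ENNReal.ofReal ((1 + K) * ‖f‖) with hX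
  have hx2 : eLpNorm f.fn 2 volume ≤ X := by
    have : eLpNorm f.fn 2 volume = ENNReal.ofReal ‖H1.fnL f‖ := by
      rw [ofReal_norm, Lp.enorm_def]; rfl
    rw [this]
    refine ENNReal.ofReal_le_ofReal (f.norm_fnL_le.trans ?_)
    nlinarith [norm_nonneg f]
  have hx6 : eLpNorm f.fn 6 volume ≤ X :=
    (hK f).trans (ENNReal.ofReal_le_ofReal (by nlinarith [norm_nonneg f]))
  have hfin : eLpNorm f.fn 4 volume ^ 4 ≤ X ^ 4 := by
    rw [show eLpNorm f.fn 4 volume ^ 4 = _ by exact_mod_cast e4]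
    refine hH.trans ?_
    calc _ ≤ X * X ^ 3 := by gcongr
      _ = X ^ 4 := by ring
  exact (ENNReal.pow_le_pow_left_iff (by norm_num)).1 hfin

/-- `L⁴(ℝ³; ℂ)`. -/
abbrev L4 := Lp ℂ 4 (volume : Measure R3)

instance fact_one_le_four : Fact ((1 : ℝ≥0∞) ≤ 4) := ⟨by norm_num⟩

instance holderTriple_four_four_two : ENNReal.HolderTriple 4 4 2 := ⟨by
  rw [← two_mul, show (4 : ℝ≥0∞) = 2 * 2 by norm_num, ENNReal.mul_inv (by simp) (by simp),
    ← mul_assoc, ENNReal.mul_inv_cancel (by simp) (by simp), one_mul]⟩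

lemma H1.memLp_four (f : H1) : MemLp f.fn 4 (volume : Measure R3) := by
  obtain ⟨K, _, hK⟩ := exists_sobolev_four
  exact ⟨Lp.aestronglyMeasurable (H1.fnL f), (hK f).trans_lt ENNReal.ofReal_lt_top⟩

lemma toLp_four_add (f g : H1) : (f + g).memLp_four.toLp (f + g).fn
    = f.memLp_four.toLp f.fn + g.memLp_four.toLp g.fn := by
  rw [← MemLp.toLp_add]
  exact MemLp.toLp_congr _ _ (Lp.coeFn_add (H1.fnL f) (H1.fnL g))

lemma toLp_four_smul (c : ℂ) (f : H1) : (c • f).memLp_four.toLp (c • f).fn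
    = c • f.memLp_four.toLp f.fn := by
  rw [← MemLp.toLp_const_smul]
  exact MemLp.toLp_congr _ _ (Lp.coeFn_smul c (H1.fnL f))

lemma exists_norm_toLp_four_le : ∃ K : ℝ, ∀ f : H1, ‖f.memLp_four.toLp f.fn‖ ≤ K * ‖f‖ := by
  obtain ⟨K, hK0, hK⟩ := exists_sobolev_four
  refine ⟨K, fun f => ?_⟩
  rw [Lp.norm_toLp]
  exact ENNReal.toReal_le_of_le_ofReal (by positivity) (hK f)

/-- The Sobolev embedding `H¹ ⊆ L⁴` as a linear map. -/
def sobolevFourLinear : H1 →ₗ[ℂ] L4 where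
  toFun f := f.memLp_four.toLp f.fn
  map_add' := toLp_four_add
  map_smul' := toLp_four_smul

/-- The Sobolev embedding `H¹ ⊆ L⁴`. -/
def sobolevFour : H1 →L[ℂ] L4 :=
  sobolevFourLinear.mkContinuousOfExistsBound exists_norm_toLp_four_le

lemma coeFn_sobolevFour (f : H1) : sobolevFour f =ᵐ[volume] f.fn := f.memLp_four.coeFn_toLp

/-! ### The evolution functional -/

/-- The product `L⁴ × L⁴ → L²`. -/
def mulFour : L4 →L[ℂ] L4 →L[ℂ] L2 := (ContinuousLinearMap.mul ℂ ℂ).holderL volume 4 4 2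

lemma coeFn_mulFour (f g : L4) : mulFour f g =ᵐ[volume] fun x => f x * g x :=
  (ContinuousLinearMap.mul ℂ ℂ).coeFn_holder f g

/-- The density `|f|²` as an element of `L²`. -/
def densityL2 (f : H1) : L2 :=
  mulFour ((Complex.conjCLE : ℂ →L[ℝ] ℂ).compLpL 4 volume (sobolevFour f)) (sobolevFour f)

lemma coeFn_densityL2 (f : H1) :
    densityL2 f =ᵐ[volume] fun x => ((‖f.fn x‖ ^ 2 : ℝ) : ℂ) := by
  filter_upwards [coeFn_mulFour ((Complex.conjCLE : ℂ →L[ℝ] ℂ).compLpL 4 volume (sobolevFour f))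
    (sobolevFour f), (Complex.conjCLE : ℂ →L[ℝ] ℂ).coeFn_compLpL (sobolevFour f),
    coeFn_sobolevFour f] with x h1 h2 h3
  rw [densityL2, h1, h2, h3]
  push_cast
  exact Complex.conj_mul' _

lemma continuous_densityL2 : Continuous densityL2 := by
  have h1 : Continuous fun f : H1 =>
      (Complex.conjCLE : ℂ →L[ℝ] ℂ).compLpL 4 volume (sobolevFour f) :=
    ((Complex.conjCLE : ℂ →L[ℝ] ℂ).compLpL 4 volume).continuous.comp sobolevFour.continuous
  exact (mulFour.continuous.comp h1).clm_apply sobolevFour.continuous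

/-- The functional `f ↦ ∫ (|u|² + β|v|²) u f`. -/
def nonlinFunctional (β : ℝ) (u v : H1) : H1 →L[ℂ] ℂ :=
  (mulPair (densityL2 u + (β : ℂ) • densityL2 v)).comp ((mulFour (sobolevFour u)).comp sobolevFour)

lemma nonlinFunctional_ae (β : ℝ) (u v f : H1) :
    (fun x => (densityL2 u + (β : ℂ) • densityL2 v : L2) x *
      mulFour (sobolevFour u) (sobolevFour f) x)
      =ᵐ[volume] fun x => nonlin β u v x * f.fn x := by
  filter_upwards [coeFn_mulFour (sobolevFour u) (sobolevFour f), coeFn_sobolevFour u,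
    coeFn_sobolevFour f, Lp.coeFn_add (densityL2 u) ((β : ℂ) • densityL2 v),
    Lp.coeFn_smul (β : ℂ) (densityL2 v), coeFn_densityL2 u, coeFn_densityL2 v]
    with x h1 h2 h3 h4 h5 h6 h7
  rw [h1, h2, h3, h4, Pi.add_apply, h5, Pi.smul_apply, h6, h7, nonlin, smul_eq_mul]
  push_cast
  ring

lemma nonlinFunctional_apply (β : ℝ) (u v f : H1) :
    nonlinFunctional β u v f = ∫ x, nonlin β u v x * f.fn x := by
  rw [← integral_congr_ae (nonlinFunctional_ae β u v f), ← mulPair_apply]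
  rfl

lemma integrable_nonlin_mul (β : ℝ) (u v f : H1) :
    Integrable fun x => nonlin β u v x * f.fn x :=
  (L2.integrable_mul _ _).congr (nonlinFunctional_ae β u v f)

lemma continuous_nonlinFunctional (β : ℝ) :
    Continuous fun p : H1 × H1 => nonlinFunctional β p.1 p.2 := by
  have h1 : Continuous fun p : H1 × H1 => mulPair (densityL2 p.1 + (β : ℂ) • densityL2 p.2) :=
    mulPair.continuous.comp ((continuous_densityL2.comp continuous_fst).add
      ((continuous_densityL2.comp continuous_snd).const_smul (β : ℂ)))
  have h2 : Continuous fun p : H1 × H1 => (mulFour (sobolevFour p.1)).comp sobolevFour :=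
    ((mulFour.continuous.comp sobolevFour.continuous).comp continuous_fst).clm_comp
      continuous_const
  exact h1.clm_comp h2

/-- The functional `f ↦ ⟨∂ₜu, f⟩` given by the first equation of the system. -/
def evolution (β : ℝ) (u v : H1) : H1 →L[ℂ] ℂ :=
  Complex.I • (-∑ j, (mulPair (H1.gradL j u)).comp (H1.gradL j) + nonlinFunctional β u v)

lemma evolution_apply (β : ℝ) (u v f : H1) :
    evolution β u v f = Complex.I * (-∑ j, mulPair (H1.gradL j u) (H1.gradL j f)
      + ∫ x, nonlin β u v x * f.fn x) := by
  simp [evolution, nonlinFunctional_apply, smul_eq_mul, mul_add]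

lemma dirichlet_eq (u : H1) {φ : R3 → ℂ} (h : IsTestFunction φ) :
    dirichlet u φ = ∑ j, ∫ x, H1.gradL j u x * pderiv j φ x :=
  integral_finsetSum _ fun j _ => integrable_mul_L2 (H1.gradL j u) (h.memLp_pderiv j)

lemma mulPair_toLp (f : L2) {φ : R3 → ℂ} (h : MemLp φ 2 (volume : Measure R3)) :
    mulPair f (h.toLp φ) = ∫ x, f x * φ x := by
  rw [mulPair_apply]
  refine integral_congr_ae ?_
  filter_upwards [h.coeFn_toLp] with x hx
  rw [hx]

lemma mulPair_fnL_toH1 (f : L2) {φ : R3 → ℂ} (h : IsTestFunction φ) :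
    mulPair f (H1.fnL h.toH1) = ∫ x, f x * φ x := mulPair_toLp f h.memLp

lemma mulPair_gradL_toH1 (f : L2) {φ : R3 → ℂ} (h : IsTestFunction φ) (j : Fin 3) :
    mulPair f (H1.gradL j h.toH1) = ∫ x, f x * pderiv j φ x := mulPair_toLp f (h.memLp_pderiv j)

lemma evolution_toH1 (β : ℝ) (u v : H1) {φ : R3 → ℂ} (h : IsTestFunction φ) :
    evolution β u v h.toH1
      = Complex.I * (-dirichlet u φ + ∫ x, nonlin β u v x * φ x) := by
  rw [evolution_apply, dirichlet_eq u h]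
  simp only [mulPair_gradL_toH1]
  have e : ∫ x, nonlin β u v x * h.toH1.fn x = ∫ x, nonlin β u v x * φ x := by
    refine integral_congr_ae ?_
    filter_upwards [h.fn_toH1] with x hx
    rw [hx]
  rw [e]

lemma continuous_evolution (β : ℝ) : Continuous fun p : H1 × H1 => evolution β p.1 p.2 := by
  have h1 : ∀ j, Continuous fun p : H1 × H1 => (mulPair (H1.gradL j p.1)).comp (H1.gradL j) :=
    fun j => ((mulPair.continuous.comp (H1.gradL j).continuous).comp continuous_fst).clm_comp
      continuous_const
  have h2 : Continuous fun p : H1 × H1 => -∑ j, (mulPair (H1.gradL j p.1)).comp (H1.gradL j) :=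
    (continuous_finsetSum _ fun j _ => h1 j).neg
  exact (h2.add (continuous_nonlinFunctional β)).const_smul Complex.I

/-! ### The equation in the dual of `H¹` -/

lemma IsSolution.swap {β : ℝ} {I : Set ℝ} {u v : ℝ → H1} (h : IsSolution β I u v) :
    IsSolution β I v u :=
  ⟨h.isOpen, h.ordConnected, h.zero_mem, h.continuousOn_v, h.continuousOn_u, h.eq_v, h.eq_u⟩

/-- The functional `f ↦ ∫ u f` on `H¹`. -/
def dualFunctional (u : H1) : H1 →L[ℂ] ℂ := (mulPair (H1.fnL u)).comp H1.fnL

lemma dualFunctional_apply (u f : H1) : dualFunctional u f = mulPair (H1.fnL u) (H1.fnL f) := rfl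

lemma dualFunctional_toH1 (u : H1) {φ : R3 → ℂ} (h : IsTestFunction φ) :
    dualFunctional u h.toH1 = ∫ x, u.fn x * φ x := mulPair_fnL_toH1 _ h

lemma IsSolution.hasDerivAt_testFunction {β : ℝ} {u v : ℝ → H1} (h : IsSolution β univ u v)
    {φ : R3 → ℂ} (hφ : IsTestFunction φ) (t : ℝ) :
    HasDerivAt (fun s => dualFunctional (u s) hφ.toH1) (evolution β (u t) (v t) hφ.toH1) t := by
  simp only [dualFunctional_toH1, evolution_toH1]
  exact h.eq_u φ hφ t (mem_univ t)

lemma IsSolution.continuous_u {β : ℝ} {u v : ℝ → H1} (h : IsSolution β univ u v) :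
    Continuous u := continuousOn_univ.1 h.continuousOn_u

lemma IsSolution.continuous_v {β : ℝ} {u v : ℝ → H1} (h : IsSolution β univ u v) :
    Continuous v := continuousOn_univ.1 h.continuousOn_v

/-- The difference quotient of the functionals `∫ u f`. -/
def dualSlope (u : ℝ → H1) (t s : ℝ) : H1 →L[ℂ] ℂ :=
  (((s - t : ℝ) : ℂ)⁻¹) • (dualFunctional (u s) - dualFunctional (u t))

lemma dualSlope_apply (u : ℝ → H1) (t s : ℝ) (f : H1) : dualSlope u t s f =
    (((s - t : ℝ) : ℂ)⁻¹) * (dualFunctional (u s) f - dualFunctional (u t) f) := rfl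

lemma norm_slope_sub_deriv_le {g g' : ℝ → ℂ} (hd : ∀ s, HasDerivAt g (g' s) s) {t r C : ℝ}
    (hC : ∀ s ∈ Metric.ball t r, ‖g' s - g' t‖ ≤ C) {s : ℝ} (hs : s ∈ Metric.ball t r)
    (hst : s ≠ t) : ‖(((s - t : ℝ) : ℂ)⁻¹) * (g s - g t) - g' t‖ ≤ C := by
  have hr : 0 < r := Metric.pos_of_mem_ball hs
  have hd' : ∀ s' ∈ Metric.ball t r, HasDerivWithinAt
      (fun s => g s - ((s - t : ℝ) : ℂ) * g' t) (g' s' - ((1 : ℝ) : ℂ) * g' t)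
      (Metric.ball t r) s' := fun s' _ =>
    ((hd s').sub (((hasDerivAt_id s').sub_const t).ofReal_comp.mul_const _)).hasDerivWithinAt
  have hb := (convex_ball t r).norm_image_sub_le_of_norm_hasDerivWithin_le
    (C := C) hd' (fun s' hs' => by
      rw [Complex.ofReal_one, one_mul]
      exact hC s' hs') (Metric.mem_ball_self hr) hs
  have hst' : ((s - t : ℝ) : ℂ) ≠ 0 := Complex.ofReal_ne_zero.2 (sub_ne_zero.2 hst)
  rw [sub_self, Complex.ofReal_zero, zero_mul, sub_zero] at hb
  rw [show (((s - t : ℝ) : ℂ)⁻¹) * (g s - g t) - g' t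
      = (((s - t : ℝ) : ℂ)⁻¹) * (g s - ((s - t : ℝ) : ℂ) * g' t - g t) by field_simp; ring,
    norm_mul, norm_inv, Complex.norm_real, inv_mul_le_iff₀ (norm_pos_iff.2 (sub_ne_zero.2 hst))]
  exact hb.trans (le_of_eq (mul_comm _ _))

lemma le_mul_norm_of_forall_testFunction (L : H1 →L[ℂ] ℂ) {C : ℝ}
    (h : ∀ (φ : R3 → ℂ) (hφ : IsTestFunction φ), ‖L hφ.toH1‖ ≤ C * ‖hφ.toH1‖) (f : H1) :
    ‖L f‖ ≤ C * ‖f‖ := by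
  have hcl : IsClosed {f : H1 | ‖L f‖ ≤ C * ‖f‖} :=
    isClosed_le L.continuous.norm (continuous_const.mul continuous_norm)
  refine hcl.closure_subset_iff.2 ?_ (dense_testFunctions f)
  rintro _ ⟨φ, hφ, rfl⟩
  exact h φ hφ

/-- The equation holds in the dual of `H¹`. -/
theorem IsSolution.eventually_norm_dualSlope_sub_le {β : ℝ} {u v : ℝ → H1}
    (h : IsSolution β univ u v) (t : ℝ) {ε : ℝ} (hε : 0 < ε) : ∀ᶠ s in 𝓝[≠] t, ∀ f : H1,
      ‖dualSlope u t s f - evolution β (u t) (v t) f‖ ≤ ε * ‖f‖ := by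
  have hc : Continuous fun s => evolution β (u s) (v s) :=
    Continuous.comp (g := fun p : H1 × H1 => evolution β p.1 p.2) (f := fun s => (u s, v s))
      (continuous_evolution β) (h.continuous_u.prodMk h.continuous_v)
  have hc' : @Continuous ℝ (H1 →L[ℂ] ℂ) _ PseudoMetricSpace.toUniformSpace.toTopologicalSpace
    fun s => evolution β (u s) (v s) := hc
  obtain ⟨r, hr, hr'⟩ := Metric.continuousAt_iff.1 hc'.continuousAt ε hε
  filter_upwards [self_mem_nhdsWithin, nhdsWithin_le_nhds (Metric.ball_mem_nhds t hr)]
    with s h1 h2 f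
  rw [← sub_apply]
  refine le_mul_norm_of_forall_testFunction _ (fun φ hφ => ?_) f
  rw [sub_apply, dualSlope_apply]
  refine norm_slope_sub_deriv_le (g := fun s => dualFunctional (u s) hφ.toH1)
    (g' := fun s => evolution β (u s) (v s) hφ.toH1)
    (fun s => h.hasDerivAt_testFunction hφ s) (fun s' hs' => ?_) h2 h1
  have : ‖evolution β (u s') (v s') - evolution β (u t) (v t)‖ ≤ ε :=
    (dist_eq_norm (evolution β (u s') (v s')) (evolution β (u t) (v t))).symm.le.trans
      (hr' (Metric.mem_ball.1 hs')).le
  rw [← sub_apply]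
  exact (ContinuousLinearMap.le_opNorm _ _).trans (by gcongr)

theorem IsSolution.tendsto_dualSlope {β : ℝ} {u v : ℝ → H1} (h : IsSolution β univ u v)
    (t : ℝ) {w : ℝ → H1} (hw : Continuous w) : Tendsto (fun s => dualSlope u t s (w s)) (𝓝[≠] t)
      (𝓝 (evolution β (u t) (v t) (w t))) := by
  have h1 : Tendsto (fun s => evolution β (u t) (v t) (w s)) (𝓝[≠] t)
      (𝓝 (evolution β (u t) (v t) (w t))) :=
    (((evolution β (u t) (v t)).continuous.comp hw).tendsto t).mono_left nhdsWithin_le_nhds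
  have h2 : Tendsto (fun s => dualSlope u t s (w s) - evolution β (u t) (v t) (w s)) (𝓝[≠] t)
      (𝓝 0) := by
    rw [Metric.tendsto_nhds]
    intro ε hε
    have hb : ∀ᶠ s in 𝓝[≠] t, ‖w s‖ < ‖w t‖ + 1 :=
      ((hw.norm.tendsto t).mono_left nhdsWithin_le_nhds).eventually
        (gt_mem_nhds (by linarith))
    have hpos : 0 < ‖w t‖ + 1 := by positivity
    filter_upwards [hb, h.eventually_norm_dualSlope_sub_le t (div_pos hε hpos)] with s hs1 hs2
    rw [dist_zero_right]
    refine (hs2 (w s)).trans_lt ?_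
    rw [div_mul_eq_mul_div, div_lt_iff₀ hpos]
    exact mul_lt_mul_of_pos_left hs1 hε
  simpa using h2.add h1

/-! ### The local mass identity -/

/-- The density `Im (ū ∂ⱼu)` of the momentum of `u`. -/
def momentumDensity (j : Fin 3) (u : H1) (x : R3) : ℝ :=
  (u.grad j x * starRingEnd ℂ (u.fn x)).im

lemma integrable_momentumDensity (j : Fin 3) (u : H1) : Integrable (momentumDensity j u) := by
  have h : Integrable fun x => u.grad j x * starRingEnd ℂ (u.fn x) := by
    refine (L2.integrable_mul (H1.gradL j u) (conjL2 (H1.fnL u))).congr ?_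
    filter_upwards [coeFn_conjL2 (H1.fnL u)] with x hx
    rw [hx]; rfl
  exact h.im

lemma abs_momentumDensity_le (j : Fin 3) (u : H1) (x : R3) :
    |momentumDensity j u x| ≤ (‖u.fn x‖ ^ 2 + ‖u.grad j x‖ ^ 2) / 2 := by
  refine (Complex.abs_im_le_norm _).trans ?_
  rw [norm_mul, RCLike.norm_conj]
  nlinarith [sq_nonneg (‖u.fn x‖ - ‖u.grad j x‖)]

lemma pderiv_ofReal {ψ : R3 → ℝ} (hψ : ContDiff ℝ ∞ ψ) (j : Fin 3) (x : R3) :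
    pderiv j (fun x => (ψ x : ℂ)) x = ((fderiv ℝ ψ x (EuclideanSpace.single j 1) : ℝ) : ℂ) := by
  have := ((Complex.ofRealCLM.hasFDerivAt (x := ψ x)).comp x
    (hψ.differentiable (by simp) x).hasFDerivAt).fderiv
  simp only [pderiv]
  change (fderiv ℝ (Complex.ofRealCLM ∘ ψ) x) _ = _
  rw [this]
  rfl

/-- `ψ f̄` as an element of `H¹`. -/
def mulConj (ψ : R3 → ℝ) (hψ : IsMultiplier fun x => (ψ x : ℂ)) (f : H1) : H1 :=
  f.conj.mul _ hψ

lemma continuous_mulConj {ψ : R3 → ℝ} (hψ : IsMultiplier fun x => (ψ x : ℂ)) :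
    Continuous (mulConj ψ hψ) := (H1.continuous_mul hψ).comp H1.continuous_conj

lemma fn_mulConj {ψ : R3 → ℝ} (hψ : IsMultiplier fun x => (ψ x : ℂ)) (f : H1) :
    (mulConj ψ hψ f).fn =ᵐ[volume] fun x => (ψ x : ℂ) * starRingEnd ℂ (f.fn x) := by
  filter_upwards [coeFn_mulL2 hψ.memLp (conjL2 (H1.fnL f)), coeFn_conjL2 (H1.fnL f)] with x h1 h2
  rw [← H1.coe_fnL, mulConj, H1.fnL_mul, H1.fnL_conj, h1, h2]
  rfl

lemma grad_mulConj {ψ : R3 → ℝ} (hψ : IsMultiplier fun x => (ψ x : ℂ)) (f : H1) (j : Fin 3) :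
    (mulConj ψ hψ f).grad j =ᵐ[volume] fun x => (ψ x : ℂ) * starRingEnd ℂ (f.grad j x)
      + pderiv j (fun x => (ψ x : ℂ)) x * starRingEnd ℂ (f.fn x) := by
  filter_upwards [coeFn_mulL2 hψ.memLp (conjL2 (H1.gradL j f)), coeFn_conjL2 (H1.fnL f),
    coeFn_conjL2 (H1.gradL j f), coeFn_mulL2 (hψ.memLp_pderiv j) (conjL2 (H1.fnL f)),
    Lp.coeFn_add (mulL2 _ hψ.memLp (conjL2 (H1.gradL j f)))
      (mulL2 _ (hψ.memLp_pderiv j) (conjL2 (H1.fnL f)))] with x h1 h2 h3 h4 h5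
  rw [← H1.coe_gradL, mulConj, H1.gradL_mul, H1.gradL_conj, H1.fnL_conj, h5, Pi.add_apply, h1, h3,
    h4, h2]
  rfl

lemma dualFunctional_mulConj {ψ : R3 → ℝ} (hψ : IsMultiplier fun x => (ψ x : ℂ)) (f g : H1) :
    dualFunctional f (mulConj ψ hψ g) = ∫ x, (ψ x : ℂ) * (f.fn x * starRingEnd ℂ (g.fn x)) := by
  rw [dualFunctional_apply, mulPair_apply]
  refine integral_congr_ae ?_
  filter_upwards [fn_mulConj hψ g] with x hx
  rw [H1.coe_fnL, H1.coe_fnL, hx]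
  ring

lemma re_dualFunctional_mulConj_comm {ψ : R3 → ℝ} (hψ : IsMultiplier fun x => (ψ x : ℂ))
    (f g : H1) : (dualFunctional f (mulConj ψ hψ g)).re = (dualFunctional g (mulConj ψ hψ f)).re := by
  have : dualFunctional f (mulConj ψ hψ g)
      = starRingEnd ℂ (dualFunctional g (mulConj ψ hψ f)) := by
    rw [dualFunctional_mulConj, dualFunctional_mulConj, ← integral_conj]
    refine integral_congr_ae (Eventually.of_forall fun x => ?_)
    simp [mul_comm]
  rw [this, Complex.conj_re]

lemma re_dualFunctional_mulConj_self {ψ : R3 → ℝ} (hψ : IsMultiplier fun x => (ψ x : ℂ))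
    (f : H1) : (dualFunctional f (mulConj ψ hψ f)).re = ∫ x, ψ x * ‖f.fn x‖ ^ 2 := by
  rw [dualFunctional_mulConj]
  have : ∀ x, (ψ x : ℂ) * (f.fn x * starRingEnd ℂ (f.fn x)) = ((ψ x * ‖f.fn x‖ ^ 2 : ℝ) : ℂ) := by
    intro x
    rw [Complex.mul_conj']
    push_cast; rfl
  simp only [this, integral_complex_ofReal, Complex.ofReal_re]

lemma re_evolution_mulConj {β : ℝ} (u v : H1) {ψ : R3 → ℝ} (hψr : ContDiff ℝ ∞ ψ)
    (hψ : IsMultiplier fun x => (ψ x : ℂ)) :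
    (evolution β u v (mulConj ψ hψ u)).re =
      ∑ j, ∫ x, fderiv ℝ ψ x (EuclideanSpace.single j 1) * momentumDensity j u x := by
  rw [evolution_apply]
  have h1 : ∀ z w : ℂ, (Complex.I * (-z + w)).re = z.im - w.im := by
    intro z w; simp; ring
  have him : ∀ F : R3 → ℂ, Integrable F → (∫ x, F x).im = ∫ x, (F x).im := by
    intro F hF
    exact (integral_im hF).symm
  rw [h1, him _ (integrable_nonlin_mul β u v _)]
  have h2 : ∫ x, (nonlin β u v x * (mulConj ψ hψ u).fn x).im = 0 := by
    refine integral_eq_zero_of_ae ?_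
    filter_upwards [fn_mulConj hψ u] with x hx
    rw [hx, nonlin]
    have : ((‖u.fn x‖ ^ 2 + β * ‖v.fn x‖ ^ 2 : ℝ) : ℂ) * u.fn x *
        ((ψ x : ℂ) * starRingEnd ℂ (u.fn x)) =
        (((‖u.fn x‖ ^ 2 + β * ‖v.fn x‖ ^ 2) * (ψ x * ‖u.fn x‖ ^ 2) : ℝ) : ℂ) := by
      have := Complex.mul_conj' (u.fn x)
      push_cast
      linear_combination ((‖u.fn x‖ ^ 2 + β * ‖v.fn x‖ ^ 2) * ψ x : ℂ) * this
    rw [this, Complex.ofReal_im]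
    rfl
  rw [h2, sub_zero, Complex.im_sum]
  refine Finset.sum_congr rfl fun j _ => ?_
  rw [mulPair_apply, him _ (L2.integrable_mul _ _)]
  refine integral_congr_ae ?_
  filter_upwards [grad_mulConj hψ u j] with x hx
  rw [H1.coe_gradL, H1.coe_gradL, hx, pderiv_ofReal hψr, momentumDensity]
  have e1 : u.grad j x * ((ψ x : ℂ) * starRingEnd ℂ (u.grad j x) +
      ((fderiv ℝ ψ x (EuclideanSpace.single j 1) : ℝ) : ℂ) * starRingEnd ℂ (u.fn x)) =
      ((ψ x * ‖u.grad j x‖ ^ 2 : ℝ) : ℂ) + ((fderiv ℝ ψ x (EuclideanSpace.single j 1) : ℝ) : ℂ) *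
        (u.grad j x * starRingEnd ℂ (u.fn x)) := by
    have := Complex.mul_conj' (u.grad j x)
    push_cast
    linear_combination (ψ x : ℂ) * this
  rw [e1, Complex.add_im, Complex.ofReal_im, zero_add, Complex.im_ofReal_mul]

/-- The local mass identity. -/
theorem IsSolution.hasDerivAt_localMass {β : ℝ} {u v : ℝ → H1} (h : IsSolution β univ u v)
    {ψ : R3 → ℝ} (hψr : ContDiff ℝ ∞ ψ) (hψ : IsMultiplier fun x => (ψ x : ℂ)) (t : ℝ) :
    HasDerivAt (fun s => ∫ x, ψ x * ‖(u s).fn x‖ ^ 2)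
      (2 * ∑ j, ∫ x, fderiv ℝ ψ x (EuclideanSpace.single j 1) * momentumDensity j (u t) x) t := by
  rw [← re_evolution_mulConj (β := β) (u t) (v t) hψr hψ]
  simp only [← re_dualFunctional_mulConj_self hψ]
  rw [hasDerivAt_iff_tendsto_slope]
  have h3 := (Complex.continuous_re.tendsto _).comp (h.tendsto_dualSlope t
    (w := fun s => mulConj ψ hψ (u s) + mulConj ψ hψ (u t)) (((continuous_mulConj hψ).comp h.continuous_u).add
      (continuous_const (y := mulConj ψ hψ (u t)))))
  have e : 2 * (evolution β (u t) (v t) (mulConj ψ hψ (u t))).re =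
      (evolution β (u t) (v t) (mulConj ψ hψ (u t) + mulConj ψ hψ (u t))).re := by
    rw [ContinuousLinearMap.map_add, Complex.add_re]; ring
  rw [e]
  refine h3.congr fun s => ?_
  have hc := re_dualFunctional_mulConj_comm hψ (u s) (u t)
  simp only [Function.comp_apply, slope_def_module, dualSlope_apply,
    ContinuousLinearMap.map_add, ← Complex.ofReal_inv,
    Complex.re_ofReal_mul, Complex.sub_re, Complex.add_re, smul_eq_mul]
  rw [hc]
  ring

/-! ### Galilean boosts -/

/-- The plane wave `e^{iξ·x}`. -/
def planeWave (ξ : R3) (x : R3) : ℂ := Complex.exp ((inner ℝ ξ x : ℝ) * Complex.I)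

lemma norm_planeWave (ξ x : R3) : ‖planeWave ξ x‖ = 1 := Complex.norm_exp_ofReal_mul_I _

lemma contDiff_planeWave (ξ : R3) : ContDiff ℝ ∞ (planeWave ξ) := by
  have h1 : ContDiff ℝ ∞ fun x : R3 => ((inner ℝ ξ x : ℝ) : ℂ) :=
    Complex.ofRealCLM.contDiff.comp (contDiff_const.inner ℝ contDiff_id)
  exact (h1.mul contDiff_const).cexp

lemma pderiv_planeWave (ξ : R3) (j : Fin 3) (x : R3) :
    pderiv j (planeWave ξ) x = Complex.I * ξ j * planeWave ξ x := by
  have h1 : HasFDerivAt (fun x : R3 => ((inner ℝ ξ x : ℝ) : ℂ) * Complex.I)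
      ((Complex.ofRealCLM.comp (innerSL ℝ ξ)).smulRight Complex.I) x := by
    have := ((Complex.ofRealCLM.comp (innerSL ℝ ξ)).smulRight Complex.I).hasFDerivAt (x := x)
    exact this
  have h2 := h1.cexp.fderiv
  simp only [pderiv]
  change (fderiv ℝ (fun x : R3 => Complex.exp (((inner ℝ ξ x : ℝ) : ℂ) * Complex.I)) x) _ = _
  rw [h2]
  simp [planeWave, EuclideanSpace.inner_single_right]
  ring

lemma isMultiplier_planeWave (ξ : R3) : IsMultiplier (planeWave ξ) := by
  refine IsMultiplier.of_bound (contDiff_planeWave ξ) (C := 1) (D := ‖ξ‖)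
    (fun x => (norm_planeWave ξ x).le) fun j x => ?_
  rw [pderiv_planeWave]
  simpa [norm_planeWave] using PiLp.norm_apply_le ξ j

/-- The time-dependent phase of a Galilean boost. -/
def boostPhase (ξ : R3) (t : ℝ) : ℂ := Complex.exp (((-(‖ξ‖ ^ 2) * t : ℝ) : ℂ) * Complex.I)

lemma norm_boostPhase (ξ : R3) (t : ℝ) : ‖boostPhase ξ t‖ = 1 := Complex.norm_exp_ofReal_mul_I _

lemma hasDerivAt_boostPhase (ξ : R3) (t : ℝ) :
    HasDerivAt (boostPhase ξ) (-(Complex.I * ‖ξ‖ ^ 2 * boostPhase ξ t)) t := by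
  have h := ((((hasDerivAt_id t).const_mul (-(‖ξ‖ ^ 2))).ofReal_comp).mul_const Complex.I).cexp
  refine h.congr_deriv ?_
  simp [boostPhase]
  ring

/-- The Galilean boost `e^{i(x·ξ - t|ξ|²)} f(x - 2tξ)`. -/
def boost (ξ : R3) (t : ℝ) (f : H1) : H1 :=
  boostPhase ξ t • (f.translate ((2 * t) • ξ)).mul (planeWave ξ) (isMultiplier_planeWave ξ)

lemma continuous_boostPhase (ξ : R3) : Continuous (boostPhase ξ) :=
  continuous_iff_continuousAt.2 fun t => (hasDerivAt_boostPhase ξ t).continuousAt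

lemma continuous_boost (ξ : R3) {u : ℝ → H1} (hu : Continuous u) :
    Continuous fun t => boost ξ t (u t) := by
  have h1 : Continuous fun t : ℝ => (u t).translate ((2 * t) • ξ) :=
    H1.continuous_translate.comp (((continuous_const.mul continuous_id).smul
      continuous_const).prodMk hu)
  have h2 := (H1.continuous_mul (isMultiplier_planeWave ξ)).comp h1
  exact (continuous_boostPhase ξ).smul h2

lemma ae_translate {p : R3 → Prop} (a : R3) (h : ∀ᵐ x, p x) : ∀ᵐ x, p (x - a) :=
  (measurePreserving_sub_right volume a).quasiMeasurePreserving.ae h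

lemma fn_boost (ξ : R3) (t : ℝ) (f : H1) : (boost ξ t f).fn =ᵐ[volume]
    fun x => boostPhase ξ t * (planeWave ξ x * f.fn (x - (2 * t) • ξ)) := by
  filter_upwards [Lp.coeFn_smul (boostPhase ξ t) (mulL2 _ (isMultiplier_planeWave ξ).memLp
      (translateL2 ((2 * t) • ξ) (H1.fnL f))),
    coeFn_mulL2 (isMultiplier_planeWave ξ).memLp (translateL2 ((2 * t) • ξ) (H1.fnL f)),
    coeFn_translateL2 ((2 * t) • ξ) (H1.fnL f)] with x h1 h2 h3
  rw [Pi.smul_apply, h2, h3] at h1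
  exact h1

lemma grad_boost (ξ : R3) (t : ℝ) (f : H1) (j : Fin 3) : (boost ξ t f).grad j =ᵐ[volume]
    fun x => boostPhase ξ t * (planeWave ξ x * (f.grad j (x - (2 * t) • ξ)
      + Complex.I * ξ j * f.fn (x - (2 * t) • ξ))) := by
  set A := mulL2 _ (isMultiplier_planeWave ξ).memLp (translateL2 ((2 * t) • ξ) (H1.gradL j f))
  set B := mulL2 _ ((isMultiplier_planeWave ξ).memLp_pderiv j)
    (translateL2 ((2 * t) • ξ) (H1.fnL f))
  filter_upwards [Lp.coeFn_smul (boostPhase ξ t) (A + B), Lp.coeFn_add A B,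
    coeFn_mulL2 (isMultiplier_planeWave ξ).memLp (translateL2 ((2 * t) • ξ) (H1.gradL j f)),
    coeFn_mulL2 ((isMultiplier_planeWave ξ).memLp_pderiv j)
      (translateL2 ((2 * t) • ξ) (H1.fnL f)),
    coeFn_translateL2 ((2 * t) • ξ) (H1.gradL j f),
    coeFn_translateL2 ((2 * t) • ξ) (H1.fnL f)] with x h1 h2 h3 h4 h5 h6
  rw [Pi.smul_apply, h2, Pi.add_apply, h3, h4, h5, h6, pderiv_planeWave, H1.coe_fnL,
    H1.coe_gradL, smul_eq_mul] at h1
  change (boostPhase ξ t • (A + B) : L2) x = _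
  rw [h1]
  ring

lemma norm_fn_boost (ξ : R3) (t : ℝ) (f : H1) :
    ∀ᵐ x, ‖(boost ξ t f).fn x‖ = ‖f.fn (x - (2 * t) • ξ)‖ := by
  filter_upwards [fn_boost ξ t f] with x hx
  rw [hx, norm_mul, norm_mul, norm_boostPhase, norm_planeWave, one_mul, one_mul]

lemma eLpNorm_boost (ξ : R3) (t : ℝ) (f : H1) (r : ℝ≥0∞) :
    eLpNorm (boost ξ t f).fn r volume = eLpNorm f.fn r volume := by
  rw [eLpNorm_congr_norm_ae (norm_fn_boost ξ t f)]
  exact eLpNorm_comp_measurePreserving (Lp.aestronglyMeasurable (H1.fnL f))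
    (measurePreserving_sub_right volume _)

lemma mass_boost (ξ : R3) (t : ℝ) (f g : H1) :
    mass (boost ξ t f) (boost ξ t g) = mass f g := by
  rw [mass, mass, ← integral_sub_right_eq_self (fun x => ‖f.fn x‖ ^ 2 + ‖g.fn x‖ ^ 2)
    ((2 * t) • ξ)]
  refine integral_congr_ae ?_
  filter_upwards [norm_fn_boost ξ t f, norm_fn_boost ξ t g] with x h1 h2
  rw [h1, h2]

/-- The `j`-th component of the momentum of `(f, g)`. -/
def momentum (j : Fin 3) (f g : H1) : ℝ := ∫ x, (momentumDensity j f x + momentumDensity j g x)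

lemma norm_add_I_mul_sq (a b : ℂ) (r : ℝ) :
    ‖a + Complex.I * r * b‖ ^ 2 = ‖a‖ ^ 2 + 2 * r * (a * starRingEnd ℂ b).im + r ^ 2 * ‖b‖ ^ 2 := by
  simp only [← Complex.normSq_eq_norm_sq, Complex.normSq_apply]
  simp
  ring

lemma H1.integrable_grad_sq (f : H1) (j : Fin 3) : Integrable fun x => ‖f.grad j x‖ ^ 2 :=
  L2.integrable_norm_sq (H1.gradL j f)

lemma H1.integrable_fn_sq (f : H1) : Integrable fun x => ‖f.fn x‖ ^ 2 :=
  L2.integrable_norm_sq (H1.fnL f)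

lemma gradSq_boost (ξ : R3) (t : ℝ) (f g : H1) : gradSq (boost ξ t f) (boost ξ t g) =
    gradSq f g + 2 * ∑ j, ξ j * momentum j f g + ‖ξ‖ ^ 2 * mass f g := by
  have e1 : gradSq (boost ξ t f) (boost ξ t g) = ∫ x, ∑ j,
      (‖f.grad j x + Complex.I * ξ j * f.fn x‖ ^ 2 +
        ‖g.grad j x + Complex.I * ξ j * g.fn x‖ ^ 2) := by
    rw [gradSq, ← integral_sub_right_eq_self (fun x => ∑ j,
      (‖f.grad j x + Complex.I * ξ j * f.fn x‖ ^ 2 +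
        ‖g.grad j x + Complex.I * ξ j * g.fn x‖ ^ 2)) ((2 * t) • ξ)]
    refine integral_congr_ae ?_
    filter_upwards [ae_all_iff.2 (grad_boost ξ t f), ae_all_iff.2 (grad_boost ξ t g)] with x h1 h2
    refine Finset.sum_congr rfl fun j _ => ?_
    rw [h1 j, h2 j]
    simp only [norm_mul, norm_boostPhase, norm_planeWave, one_mul]
  have e2 : ∀ x, ∑ j, (‖f.grad j x + Complex.I * ξ j * f.fn x‖ ^ 2 +
        ‖g.grad j x + Complex.I * ξ j * g.fn x‖ ^ 2) =
      ∑ j, (‖f.grad j x‖ ^ 2 + ‖g.grad j x‖ ^ 2)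
      + ∑ j, 2 * ξ j * (momentumDensity j f x + momentumDensity j g x)
      + ‖ξ‖ ^ 2 * (‖f.fn x‖ ^ 2 + ‖g.fn x‖ ^ 2) := by
    intro x
    rw [EuclideanSpace.real_norm_sq_eq, Finset.sum_mul, ← Finset.sum_add_distrib,
      ← Finset.sum_add_distrib]
    refine Finset.sum_congr rfl fun j _ => ?_
    rw [norm_add_I_mul_sq, norm_add_I_mul_sq, momentumDensity, momentumDensity]
    ring
  have i1 : Integrable fun x => ∑ j, (‖f.grad j x‖ ^ 2 + ‖g.grad j x‖ ^ 2) :=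
    integrable_finsetSum _ fun j _ => (f.integrable_grad_sq j).add (g.integrable_grad_sq j)
  have i2 : ∀ j, Integrable fun x =>
      2 * ξ j * (momentumDensity j f x + momentumDensity j g x) := fun j =>
    ((integrable_momentumDensity j f).add (integrable_momentumDensity j g)).const_mul _
  have i3 : Integrable fun x => ‖ξ‖ ^ 2 * (‖f.fn x‖ ^ 2 + ‖g.fn x‖ ^ 2) :=
    (f.integrable_fn_sq.add g.integrable_fn_sq).const_mul _
  rw [e1]
  simp only [e2]
  have i2' : Integrable fun x =>
      ∑ j, 2 * ξ j * (momentumDensity j f x + momentumDensity j g x) :=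
    integrable_finsetSum _ fun j _ => i2 j
  have i12 : Integrable fun x => ∑ j, (‖f.grad j x‖ ^ 2 + ‖g.grad j x‖ ^ 2)
      + ∑ j, 2 * ξ j * (momentumDensity j f x + momentumDensity j g x) := i1.add i2'
  rw [integral_add i12 i3, integral_add i1 i2', integral_finsetSum _ fun j _ => i2 j,
    integral_const_mul]
  simp only [integral_const_mul]
  rw [Finset.mul_sum]
  simp only [gradSq, mass, momentum, mul_assoc]

lemma energy_boost (β : ℝ) (ξ : R3) (t : ℝ) (f g : H1) :
    energy β (boost ξ t f) (boost ξ t g) =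
      energy β f g + ∑ j, ξ j * momentum j f g + 1 / 2 * ‖ξ‖ ^ 2 * mass f g := by
  have e : ∫ x, (‖(boost ξ t f).fn x‖ ^ 4
        + 2 * β * ‖(boost ξ t f).fn x * (boost ξ t g).fn x‖ ^ 2 + ‖(boost ξ t g).fn x‖ ^ 4) =
      ∫ x, (‖f.fn x‖ ^ 4 + 2 * β * ‖f.fn x * g.fn x‖ ^ 2 + ‖g.fn x‖ ^ 4) := by
    rw [← integral_sub_right_eq_self (fun x => ‖f.fn x‖ ^ 4 + 2 * β * ‖f.fn x * g.fn x‖ ^ 2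
      + ‖g.fn x‖ ^ 4) ((2 * t) • ξ)]
    refine integral_congr_ae ?_
    filter_upwards [norm_fn_boost ξ t f, norm_fn_boost ξ t g] with x h1 h2
    rw [norm_mul, norm_mul, h1, h2]
  rw [energy, energy, e, gradSq_boost]
  ring

/-! ### Galilean invariance of the system -/

lemma hasDerivAt_integral_mul_translate (f : L2) {χ : R3 → ℂ} (hχ : IsTestFunction χ) (v : R3)
    (t : ℝ) : HasDerivAt (fun s : ℝ => ∫ y, f y * χ (y + s • v))
      (∫ y, f y * fderiv ℝ χ (y + t • v) v) t := by
  have hli : LocallyIntegrable f volume := (Lp.memLp f).locallyIntegrable (by norm_num)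
  set χ' : R3 → ℂ := fun z => χ (-z) with hχ'
  have hc : ContDiff ℝ ∞ χ' := hχ.1.comp contDiff_neg
  have hs : HasCompactSupport χ' := hχ.2.comp_homeomorph (Homeomorph.neg R3)
  have h1 := hs.hasFDerivAt_convolution_right (μ := (volume : Measure R3))
    (ContinuousLinearMap.mul ℝ ℂ) hli (hc.of_le (by simp)) (-(t • v))
  have h2 : HasDerivAt (fun s : ℝ => -(s • v)) (-v) t := by
    exact ((hasDerivAt_id t).smul_const v).neg.congr_deriv (by simp)
  have h3 := h1.comp_hasDerivAt t h2
  have hd : ∀ z, fderiv ℝ χ' z (-v) = fderiv ℝ χ (-z) v := by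
    intro z
    have := ((hχ.differentiable (-z)).hasFDerivAt.comp z (hasFDerivAt_id z).neg).fderiv
    change (fderiv ℝ (χ ∘ fun z => -z) z) _ = _
    erw [this]
    simp
  refine (h3.congr_deriv ?_).congr_of_eventuallyEq (Eventually.of_forall fun s => ?_)
  · rw [convolution, ContinuousLinearMap.integral_apply]
    · refine integral_congr_ae (Eventually.of_forall fun y => ?_)
      change f y * fderiv ℝ χ' (-(t • v) - y) (-v) = _
      rw [hd]
      congr 3
      abel
    · exact (hs.fderiv (𝕜 := ℝ)).convolutionExists_right
        ((ContinuousLinearMap.mul ℝ ℂ).precompR R3) hli (hc.continuous_fderiv (by simp)) _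
  · simp only [Function.comp_apply, convolution, hχ', ContinuousLinearMap.mul_apply']
    refine integral_congr_ae (Eventually.of_forall fun y => ?_)
    simp only []
    congr 2
    abel

lemma IsTestFunction.toH1_comp_add {χ : R3 → ℂ} (hχ : IsTestFunction χ) (a : R3) :
    (hχ.comp_add a).toH1 = hχ.toH1.translate (-a) := by
  refine H1.ext' (Lp.ext ?_) fun j => Lp.ext ?_
  · filter_upwards [(hχ.comp_add a).fn_toH1, coeFn_translateL2 (-a) (H1.fnL hχ.toH1),
      ae_translate (-a) hχ.fn_toH1] with x h1 h2 h3
    rw [H1.fnL_translate, h2, H1.coe_fnL, h1, H1.coe_fnL, h3, sub_neg_eq_add]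
  · filter_upwards [(hχ.comp_add a).grad_toH1 j, coeFn_translateL2 (-a) (H1.gradL j hχ.toH1),
      ae_translate (-a) (hχ.grad_toH1 j)] with x h1 h2 h3
    rw [H1.gradL_translate, h2, H1.coe_gradL, h1, H1.coe_gradL, h3, sub_neg_eq_add]
    simp only [NLSSystem.pderiv]
    rw [fderiv_comp_add_right]

/-- The test function `e^{iξ·x} φ`. -/
lemma IsTestFunction.planeWave_mul {φ : R3 → ℂ} (hφ : IsTestFunction φ) (ξ : R3) :
    IsTestFunction fun x => planeWave ξ x * φ x := hφ.mul_left (contDiff_planeWave ξ)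

lemma integral_boost_mul (ξ : R3) (t : ℝ) (f : H1) (φ : R3 → ℂ) :
    ∫ x, (boost ξ t f).fn x * φ x = boostPhase ξ t *
      ∫ y, f.fn y * (planeWave ξ (y + (2 * t) • ξ) * φ (y + (2 * t) • ξ)) := by
  rw [← integral_sub_right_eq_self (fun y => f.fn y * (planeWave ξ (y + (2 * t) • ξ)
    * φ (y + (2 * t) • ξ))) ((2 * t) • ξ), ← integral_const_mul]
  refine integral_congr_ae ?_
  filter_upwards [fn_boost ξ t f] with x hx
  rw [hx, sub_add_cancel]
  ring

lemma integral_nonlin_boost_mul (β : ℝ) (ξ : R3) (t : ℝ) (f g : H1) (φ : R3 → ℂ) :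
    ∫ x, nonlin β (boost ξ t f) (boost ξ t g) x * φ x = boostPhase ξ t *
      ∫ y, nonlin β f g y * (planeWave ξ (y + (2 * t) • ξ) * φ (y + (2 * t) • ξ)) := by
  rw [← integral_sub_right_eq_self (fun y => nonlin β f g y * (planeWave ξ (y + (2 * t) • ξ)
    * φ (y + (2 * t) • ξ))) ((2 * t) • ξ), ← integral_const_mul]
  refine integral_congr_ae ?_
  filter_upwards [fn_boost ξ t f, norm_fn_boost ξ t f, norm_fn_boost ξ t g] with x h1 h2 h3
  rw [nonlin, nonlin, h2, h3, h1, sub_add_cancel]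
  ring

lemma integral_sub_mul_add {a b c d : R3 → ℂ} (ha : Integrable a) (hb : Integrable b)
    (hc : Integrable c) (hd : Integrable d) (p q r : ℂ) :
    ∫ y, ((a y - p * b y) + (q * c y + r * d y)) =
      ((∫ y, a y) - p * ∫ y, b y) + (q * (∫ y, c y) + r * ∫ y, d y) := by
  have h1 : Integrable fun y => a y - p * b y := ha.sub (hb.const_mul p)
  have h2 : Integrable fun y => q * c y + r * d y := (hc.const_mul q).add (hd.const_mul r)
  rw [integral_add h1 h2, integral_sub ha (hb.const_mul p),
    integral_add (hc.const_mul q) (hd.const_mul r), integral_const_mul, integral_const_mul,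
    integral_const_mul]

lemma planeWave_mul_pderiv (ξ a : R3) {φ : R3 → ℂ} (hφ : IsTestFunction φ) (j : Fin 3) (y : R3) :
    planeWave ξ (y + a) * pderiv j φ (y + a) =
      pderiv j (fun y => planeWave ξ (y + a) * φ (y + a)) y
        - Complex.I * ξ j * (planeWave ξ (y + a) * φ (y + a)) := by
  have h1 : pderiv j (fun y => planeWave ξ (y + a) * φ (y + a)) y
      = pderiv j (fun x => planeWave ξ x * φ x) (y + a) := by
    simp only [pderiv]
    rw [fderiv_comp_add_right (f := fun x => planeWave ξ x * φ x)]
  rw [h1, pderiv_mul ((contDiff_planeWave ξ).differentiable (by simp)) hφ.differentiable,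
    pderiv_planeWave]
  ring

lemma grad_boost_mul_pderiv_ae (ξ : R3) (t : ℝ) (f : H1) {φ : R3 → ℂ}
    (hφ : IsTestFunction φ) {χ : R3 → ℂ}
    (hχ : χ = fun y => planeWave ξ (y + (2 * t) • ξ) * φ (y + (2 * t) • ξ)) (j : Fin 3) :
    ∀ᵐ x, (boost ξ t f).grad j x * pderiv j φ x = boostPhase ξ t *
      ((f.grad j (x - (2 * t) • ξ) * pderiv j χ (x - (2 * t) • ξ)
        - Complex.I * ξ j * (f.grad j (x - (2 * t) • ξ) * χ (x - (2 * t) • ξ)))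
        + (Complex.I * ξ j * (f.fn (x - (2 * t) • ξ) * pderiv j χ (x - (2 * t) • ξ))
        + (ξ j : ℂ) ^ 2 * (f.fn (x - (2 * t) • ξ) * χ (x - (2 * t) • ξ)))) := by
  filter_upwards [grad_boost ξ t f j] with x hx
  have h2 := planeWave_mul_pderiv ξ ((2 * t) • ξ) hφ j (x - (2 * t) • ξ)
  rw [← hχ, sub_add_cancel] at h2
  have h3 : χ (x - (2 * t) • ξ) = planeWave ξ x * φ x := by rw [hχ]; simp
  rw [← h3] at h2
  rw [hx]
  generalize f.grad j (x - (2 * t) • ξ) = g at *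
  generalize f.fn (x - (2 * t) • ξ) = f at *
  generalize χ (x - (2 * t) • ξ) = c at *
  linear_combination boostPhase ξ t * (g + Complex.I * ξ j * f) * h2
    - boostPhase ξ t * f * (ξ j : ℂ) ^ 2 * c * Complex.I_sq

lemma integral_grad_boost_mul_pderiv (ξ : R3) (t : ℝ) (f : H1) {φ : R3 → ℂ}
    (hφ : IsTestFunction φ) {χ : R3 → ℂ}
    (hχ : χ = fun y => planeWave ξ (y + (2 * t) • ξ) * φ (y + (2 * t) • ξ)) (j : Fin 3) :
    ∫ x, (boost ξ t f).grad j x * pderiv j φ x = boostPhase ξ t *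
      ((∫ y, f.grad j y * pderiv j χ y) + 2 * Complex.I * (ξ j * ∫ y, f.fn y * pderiv j χ y)
        + (ξ j : ℂ) ^ 2 * ∫ y, f.fn y * χ y) := by
  have hχt : IsTestFunction χ := by
    rw [hχ]; exact (hφ.planeWave_mul ξ).comp_add _
  have i1 : Integrable fun y => f.grad j y * pderiv j χ y :=
    integrable_mul_L2 (H1.gradL j f) (hχt.memLp_pderiv j)
  have i2 : Integrable fun y => f.grad j y * χ y := integrable_mul_L2 (H1.gradL j f) hχt.memLp
  have i3 : Integrable fun y => f.fn y * pderiv j χ y :=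
    integrable_mul_L2 (H1.fnL f) (hχt.memLp_pderiv j)
  have i4 : Integrable fun y => f.fn y * χ y := integrable_mul_L2 (H1.fnL f) hχt.memLp
  have h3 : ∫ y, f.fn y * pderiv j χ y = -∫ y, f.grad j y * χ y := f.isWeakGrad χ hχt j
  have h4 := integral_sub_mul_add i1 i2 i3 i4 (Complex.I * ξ j) (Complex.I * ξ j) ((ξ j : ℂ) ^ 2)
  rw [integral_congr_ae (grad_boost_mul_pderiv_ae ξ t f hφ hχ j), integral_const_mul,
    integral_sub_right_eq_self (fun y => (f.grad j y * pderiv j χ y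
      - Complex.I * ξ j * (f.grad j y * χ y)) + (Complex.I * ξ j * (f.fn y * pderiv j χ y)
      + (ξ j : ℂ) ^ 2 * (f.fn y * χ y))) ((2 * t) • ξ), h4]
  generalize ∫ y, f.grad j y * χ y = A at *
  generalize ∫ y, f.fn y * pderiv j χ y = B at *
  linear_combination (-boostPhase ξ t * Complex.I * ξ j) * h3

lemma dirichlet_boost (ξ : R3) (t : ℝ) (f : H1) {φ : R3 → ℂ} (hφ : IsTestFunction φ) {χ : R3 → ℂ}
    (hχ : χ = fun y => planeWave ξ (y + (2 * t) • ξ) * φ (y + (2 * t) • ξ)) :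
    dirichlet (boost ξ t f) φ = boostPhase ξ t * (dirichlet f χ +
      2 * Complex.I * ∑ j, ξ j * (∫ y, f.fn y * pderiv j χ y)
      + ‖ξ‖ ^ 2 * ∫ y, f.fn y * χ y) := by
  have hχt : IsTestFunction χ := by
    rw [hχ]; exact (hφ.planeWave_mul ξ).comp_add _
  rw [dirichlet_eq _ hφ, dirichlet_eq _ hχt]
  simp only [H1.coe_gradL, integral_grad_boost_mul_pderiv ξ t f hφ hχ]
  rw [← Finset.mul_sum, Finset.sum_add_distrib, Finset.sum_add_distrib, ← Finset.mul_sum,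
    ← Finset.sum_mul]
  have h4 : ((‖ξ‖ : ℂ)) ^ 2 = ∑ j, (ξ j : ℂ) ^ 2 := by
    have := EuclideanSpace.real_norm_sq_eq ξ
    exact_mod_cast congrArg (fun r : ℝ => (r : ℂ)) this
  rw [h4]

lemma fderiv_apply_eq_sum (χ : R3 → ℂ) (y ξ : R3) :
    fderiv ℝ χ y ξ = ∑ j, (ξ j : ℂ) * pderiv j χ y := by
  have hx : ξ = ∑ j, ξ j • (EuclideanSpace.single j (1 : ℝ) : R3) := by
    have := (EuclideanSpace.basisFun (Fin 3) ℝ).sum_repr ξ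
    simpa using this.symm
  nth_rewrite 1 [hx]
  simp [map_sum, pderiv]

lemma IsTestFunction.continuous_toH1_comp_add {χ : R3 → ℂ} (hχ : IsTestFunction χ) (ξ : R3) :
    Continuous fun s : ℝ => (hχ.comp_add ((2 * s) • ξ)).toH1 := by
  simp only [hχ.toH1_comp_add]
  exact H1.continuous_translate.comp
    ((((continuous_const.mul continuous_id).smul continuous_const).neg).prodMk continuous_const)

lemma hasDerivAt_integral_mul_comp_add (f : L2) {χ : R3 → ℂ} (hχ : IsTestFunction χ) (ξ : R3)
    (t : ℝ) : HasDerivAt (fun s : ℝ => ∫ y, f y * χ (y + (2 * s) • ξ))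
      (2 * ∑ j, ξ j * ∫ y, f y * pderiv j (fun y => χ (y + (2 * t) • ξ)) y) t := by
  have h1 := hasDerivAt_integral_mul_translate f hχ ((2 : ℝ) • ξ) t
  have e : ∀ s : ℝ, s • (2 : ℝ) • ξ = (2 * s) • ξ := fun s => by rw [smul_smul, mul_comm]
  simp only [e] at h1
  refine h1.congr_deriv ?_
  have e2 : ∀ y, f y * fderiv ℝ χ (y + (2 * t) • ξ) ((2 : ℝ) • ξ) =
      ∑ j, 2 * ((ξ j : ℂ) * (f y * pderiv j (fun y => χ (y + (2 * t) • ξ)) y)) := by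
    intro y
    rw [map_smul, fderiv_apply_eq_sum, Complex.real_smul, Finset.mul_sum, Finset.mul_sum]
    refine Finset.sum_congr rfl fun j _ => ?_
    simp only [pderiv]
    rw [fderiv_comp_add_right]
    push_cast
    ring
  simp only [e2]
  rw [integral_finsetSum _ fun j _ => ((integrable_mul_L2 f
    ((hχ.comp_add ((2 * t) • ξ)).memLp_pderiv j)).const_mul _).const_mul _, Finset.mul_sum]
  simp only [integral_const_mul]

lemma IsSolution.hasDerivAt_dualFunctional {β : ℝ} {u v : ℝ → H1} (h : IsSolution β univ u v)
    {w : ℝ → H1} (hw : Continuous w) {t : ℝ} {c : ℂ}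
    (hc : HasDerivAt (fun s => dualFunctional (u t) (w s)) c t) :
    HasDerivAt (fun s => dualFunctional (u s) (w s)) (evolution β (u t) (v t) (w t) + c) t := by
  rw [hasDerivAt_iff_tendsto_slope] at hc ⊢
  refine ((h.tendsto_dualSlope t hw).add hc).congr fun s => ?_
  simp only [slope_def_module, dualSlope_apply, Complex.real_smul, Complex.ofReal_inv]
  ring

/-- The boosted solution satisfies the first equation of the system. -/
theorem IsSolution.hasDerivAt_boost {β : ℝ} {u v : ℝ → H1} (h : IsSolution β univ u v) (ξ : R3)
    {φ : R3 → ℂ} (hφ : IsTestFunction φ) (t : ℝ) :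
    HasDerivAt (fun s => ∫ x, (boost ξ s (u s)).fn x * φ x)
      (Complex.I * (-dirichlet (boost ξ t (u t)) φ +
        ∫ x, nonlin β (boost ξ t (u t)) (boost ξ t (v t)) x * φ x)) t := by
  have hχ := hφ.planeWave_mul ξ
  have hdual : ∀ (f : H1) (s : ℝ), dualFunctional f (hχ.comp_add ((2 * s) • ξ)).toH1
      = ∫ y, f.fn y * (planeWave ξ (y + (2 * s) • ξ) * φ (y + (2 * s) • ξ)) :=
    fun f s => dualFunctional_toH1 f _
  have hG2 := hasDerivAt_integral_mul_comp_add (H1.fnL (u t)) hχ ξ t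
  rw [H1.coe_fnL] at hG2
  simp only [← hdual] at hG2
  have hfin := (hasDerivAt_boostPhase ξ t).mul
    (h.hasDerivAt_dualFunctional (hχ.continuous_toH1_comp_add ξ) hG2)
  rw [evolution_toH1] at hfin
  simp only [integral_boost_mul, ← hdual]
  refine hfin.congr_deriv ?_
  rw [dirichlet_boost ξ t (u t) hφ rfl, integral_nonlin_boost_mul, ← hdual]
  generalize boostPhase ξ t = c
  generalize dualFunctional (u t) _ = K
  generalize (∑ j : Fin 3, (ξ j : ℂ) * ∫ y, (u t).fn y *
    pderiv j (fun y => planeWave ξ (y + (2 * t) • ξ) * φ (y + (2 * t) • ξ)) y) = S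
  generalize dirichlet (u t) _ = D
  generalize ∫ x, nonlin β (u t) (v t) x * _ = N
  linear_combination (2 * c * S) * Complex.I_sq

/-- Galilean invariance. -/
theorem IsSolution.boost {β : ℝ} {u v : ℝ → H1} (h : IsSolution β univ u v) (ξ : R3) :
    IsSolution β univ (fun t => boost ξ t (u t)) (fun t => boost ξ t (v t)) where
  isOpen := isOpen_univ
  ordConnected := ordConnected_univ
  zero_mem := mem_univ 0
  continuousOn_u := (continuous_boost ξ h.continuous_u).continuousOn
  continuousOn_v := (continuous_boost ξ h.continuous_v).continuousOn
  eq_u _ hφ t _ := h.hasDerivAt_boost ξ hφ t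
  eq_v _ hφ t _ := h.swap.hasDerivAt_boost ξ hφ t

/-! ### Critical solutions have zero momentum -/

lemma IsSolution.shift {β : ℝ} {u v : ℝ → H1} (h : IsSolution β univ u v) (t₀ : ℝ) :
    IsSolution β univ (fun s => u (s + t₀)) (fun s => v (s + t₀)) where
  isOpen := isOpen_univ
  ordConnected := ordConnected_univ
  zero_mem := mem_univ 0
  continuousOn_u := (h.continuous_u.comp (continuous_add_const t₀)).continuousOn
  continuousOn_v := (h.continuous_v.comp (continuous_add_const t₀)).continuousOn
  eq_u φ hφ t _ := (h.eq_u φ hφ (t + t₀) (mem_univ _)).comp_add_const t t₀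
  eq_v φ hφ t _ := (h.eq_v φ hφ (t + t₀) (mem_univ _)).comp_add_const t t₀

lemma mixedNorm_boost_shift (q r : ℝ≥0∞) (ξ : R3) (t₀ : ℝ) (u : ℝ → H1) :
    mixedNorm q r univ (fun s => boost ξ s (u (s + t₀))) = mixedNorm q r univ u := by
  simp only [mixedNorm, eLpNorm_boost, Measure.restrict_univ]
  have h := (MeasurableEquiv.addRight t₀).measurableEmbedding.eLpNorm_map_measure
    (p := q) (μ := volume) (g := fun t => eLpNorm (u t).fn r volume)
  have hm : Measure.map (MeasurableEquiv.addRight t₀) (volume : Measure ℝ) = volume :=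
    map_add_right_eq_self volume t₀
  rw [hm] at h
  exact h.symm

lemma strichartzNorm_boost_shift (r₁ : ℝ) (ξ : R3) (t₀ : ℝ) (u : ℝ → H1) :
    strichartzNorm r₁ univ (fun s => boost ξ s (u (s + t₀))) = strichartzNorm r₁ univ u := by
  simp only [strichartzNorm, mixedNorm_boost_shift]

lemma not_SC_of_isSolution {β r₁ : ℝ} {u v : ℝ → H1} (h : IsSolution β univ u v)
    (htop : strichartzNorm r₁ univ u + strichartzNorm r₁ univ v = ⊤) :
    ¬ SC β r₁ (u 0) (v 0) := by
  rintro ⟨I, u', v', ⟨_, hmax⟩, hu, hv, _, hlt⟩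
  obtain ⟨hI, heq⟩ := hmax univ u v h hu.symm hv.symm
  have hI' : I = univ := univ_subset_iff.1 hI
  have hu' : u' = u := funext fun t => ((heq t (mem_univ t)).1).symm
  have hv' : v' = v := funext fun t => ((heq t (mem_univ t)).2).symm
  rw [hI', hu', hv', htop] at hlt
  exact lt_irrefl _ hlt

/-- By Galilean invariance and minimality, a critical solution has zero momentum. -/
theorem IsCriticalSolution.momentum_eq_zero {β r₁ : ℝ} {P Q : H1} {u v : ℝ → H1}
    (h : IsCriticalSolution β r₁ P Q u v) (t : ℝ) (j : Fin 3) : momentum j (u t) (v t) = 0 := by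
  by_contra hne
  set ξ : R3 := WithLp.toLp 2 fun j => -momentum j (u t) (v t) with hξ
  have hξj : ∀ j, momentum j (u t) (v t) = -ξ j := fun j => by simp [hξ]
  have hsum : ∑ j, ξ j * momentum j (u t) (v t) = -‖ξ‖ ^ 2 := by
    rw [EuclideanSpace.real_norm_sq_eq, ← Finset.sum_neg_distrib]
    refine Finset.sum_congr rfl fun j _ => ?_
    rw [hξj]; ring
  have hpos : 0 < ‖ξ‖ ^ 2 := by
    have : ξ ≠ 0 := fun h0 => hne (by rw [hξj, h0]; simp)
    positivity
  have hm := h.mass_eq t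
  have hgrad := h.gradSq_lt t
  have hlevel := h.energy_eq t
  have hlt : ((energy β (boost ξ 0 (u t)) (boost ξ 0 (v t)) : ℝ) : EReal)
      < criticalLevel β r₁ P Q := by
    rw [← hlevel, EReal.coe_lt_coe_iff, energy_boost, hsum, hm]
    linarith
  obtain ⟨_, ⟨δ, hδ, rfl⟩, hδ'⟩ := lt_sSup_iff.1 hlt
  have hSC := hδ (boost ξ 0 (u t)) (boost ξ 0 (v t))
    (by
      rw [mass_boost, gradSq_boost, hsum, hm]
      rw [hm] at hgrad
      linarith)
    (by
      rw [mass_boost, hm, one_mul]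
      exact EReal.coe_lt_coe_iff.1 hδ')
  have hsol := (h.isSolution.shift t).boost ξ
  refine not_SC_of_isSolution (r₁ := r₁) hsol ?_ ?_
  · rw [strichartzNorm_boost_shift r₁ ξ t u, strichartzNorm_boost_shift r₁ ξ t v]
    exact h.norm_eq_top
  · simpa using hSC

/-! ### Uniform localization of precompact families -/

/-- The exterior of the ball of radius `R` about `c`. -/
def farSet (c : R3) (R : ℝ) : Set R3 := {y | R < ‖y - c‖}

lemma measurableSet_farSet (c : R3) (R : ℝ) : MeasurableSet (farSet c R) :=
  measurableSet_lt measurable_const (measurable_id.sub_const c).norm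

lemma L2.setIntegral_norm_sq_le (f g : L2) (S : Set R3) :
    ∫ x in S, ‖g x‖ ^ 2 ≤ 2 * (∫ x in S, ‖f x‖ ^ 2) + 2 * ‖g - f‖ ^ 2 := by
  have h1 : ∫ x in S, ‖g x‖ ^ 2 ≤ ∫ x in S, (2 * ‖f x‖ ^ 2 + 2 * ‖(g - f : L2) x‖ ^ 2) := by
    refine integral_mono_ae (L2.integrable_norm_sq g).integrableOn
      (((L2.integrable_norm_sq f).const_mul 2).add
        ((L2.integrable_norm_sq (g - f)).const_mul 2)).integrableOn ?_
    refine ae_restrict_of_ae ?_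
    filter_upwards [Lp.coeFn_sub g f] with x hx
    rw [hx, Pi.sub_apply]
    have h2 : ‖g x‖ ≤ ‖f x‖ + ‖g x - f x‖ := by
      simpa using norm_add_le (f x) (g x - f x)
    nlinarith [sq_nonneg (‖f x‖ - ‖g x - f x‖), norm_nonneg (g x)]
  rw [integral_add ((L2.integrable_norm_sq f).const_mul 2).integrableOn
    ((L2.integrable_norm_sq (g - f)).const_mul 2).integrableOn, integral_const_mul,
    integral_const_mul] at h1
  have h3 : ∫ x in S, ‖(g - f : L2) x‖ ^ 2 ≤ ‖g - f‖ ^ 2 := by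
    rw [L2.norm_sq]
    exact setIntegral_le_integral (L2.integrable_norm_sq (g - f))
      (Eventually.of_forall fun x => by positivity)
  linarith

lemma L2.setIntegral_farSet_anti (f : L2) (c : R3) {R R' : ℝ} (h : R ≤ R') :
    ∫ x in farSet c R', ‖f x‖ ^ 2 ≤ ∫ x in farSet c R, ‖f x‖ ^ 2 :=
  setIntegral_mono_set (L2.integrable_norm_sq f).integrableOn
    (Eventually.of_forall fun x => by positivity)
    (LE.le.eventuallyLE fun _ hy => lt_of_le_of_lt h hy)

lemma exists_uniform_tail {K : Set L2} (hK : IsCompact K) {ε : ℝ} (hε : 0 < ε) :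
    ∃ R : ℝ, 0 ≤ R ∧ ∀ f ∈ K, ∫ x in farSet 0 R, ‖f x‖ ^ 2 ≤ ε := by
  refine hK.induction_on (p := fun s => ∃ R : ℝ, 0 ≤ R ∧
    ∀ f ∈ s, ∫ x in farSet 0 R, ‖f x‖ ^ 2 ≤ ε) ?_ ?_ ?_ ?_
  · exact ⟨0, le_rfl, fun f hf => absurd hf (notMem_empty f)⟩
  · rintro s t hst ⟨R, h0, h⟩
    exact ⟨R, h0, fun f hf => h f (hst hf)⟩
  · rintro s t ⟨R, h0, h⟩ ⟨R', h0', h'⟩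
    refine ⟨max R R', le_max_of_le_left h0, ?_⟩
    rintro f (hf | hf)
    · exact (L2.setIntegral_farSet_anti f 0 (le_max_left _ _)).trans (h f hf)
    · exact (L2.setIntegral_farSet_anti f 0 (le_max_right _ _)).trans (h' f hf)
  · intro f _
    have h1 : ∀ᶠ R : ℝ in atTop, ∫ x in {x : R3 | R < ‖x‖}, ‖f x‖ ^ 2 < ε / 4 :=
      (L2.tendsto_tail f).eventually (gt_mem_nhds (by positivity))
    obtain ⟨R, hR, hR0⟩ := (h1.and (eventually_ge_atTop 0)).exists
    refine ⟨Metric.ball f (Real.sqrt (ε / 4)), mem_nhdsWithin_of_mem_nhds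
      (Metric.ball_mem_nhds f (by positivity)), R, hR0, fun g hg => ?_⟩
    have hS : farSet 0 R = {x : R3 | R < ‖x‖} := by simp [farSet]
    have h2 := L2.setIntegral_norm_sq_le f g (farSet 0 R)
    have h3 : ‖g - f‖ < Real.sqrt (ε / 4) := by
      have := Metric.mem_ball.1 hg
      rwa [dist_eq_norm] at this
    have h4 : ‖g - f‖ ^ 2 < ε / 4 := (Real.lt_sqrt (norm_nonneg _)).1 h3
    rw [hS] at h2 ⊢
    linarith

lemma setIntegral_translateL2 (a : R3) (f : L2) (R : ℝ) :
    ∫ x in farSet 0 R, ‖translateL2 a f x‖ ^ 2 = ∫ x in farSet (-a) R, ‖f x‖ ^ 2 := by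
  rw [← integral_indicator (measurableSet_farSet _ _),
    ← integral_indicator (measurableSet_farSet _ _),
    ← integral_sub_right_eq_self ((farSet (-a) R).indicator fun x => ‖f x‖ ^ 2) a]
  refine integral_congr_ae ?_
  filter_upwards [coeFn_translateL2 a f] with x hx
  have hiff : x ∈ farSet 0 R ↔ x - a ∈ farSet (-a) R := by simp [farSet]
  by_cases h : x ∈ farSet 0 R
  · rw [indicator_of_mem h, indicator_of_mem (hiff.1 h), hx]
  · rw [indicator_of_notMem h, indicator_of_notMem fun h' => h (hiff.2 h')]

/-! ### Truncated coordinate functions -/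

lemma exists_truncation : ∃ θ : ℝ → ℝ, ContDiff ℝ ∞ θ ∧ (∀ s, |s| ≤ 1 → θ s = s) ∧
    (∀ s, |θ s| ≤ 2) ∧ (∀ s, |s| < 1 → deriv θ s = 1) ∧
    ∃ D : ℝ, 0 ≤ D ∧ ∀ s, |deriv θ s| ≤ D := by
  set b : ContDiffBump (0 : ℝ) := ⟨1, 2, one_pos, one_lt_two⟩ with hb
  have hc : ContDiff ℝ ∞ fun s => s * b s := contDiff_id.mul b.contDiff
  have hs : HasCompactSupport fun s => s * b s := b.hasCompactSupport.mul_left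
  have h1 : ∀ s, |s| ≤ 1 → s * b s = s := fun s h => by
    rw [b.one_of_mem_closedBall (by simpa using h), mul_one]
  refine ⟨fun s => s * b s, hc, h1, fun s => ?_, fun s h => ?_, ?_⟩
  · change |s * b s| ≤ 2
    by_cases h : |s| < 2
    · rw [abs_mul, abs_of_nonneg b.nonneg]
      exact (mul_le_of_le_one_right (abs_nonneg s) b.le_one).trans h.le
    · rw [b.zero_of_le_dist (by simpa using h)]
      simp
  · have : (fun s => s * b s) =ᶠ[𝓝 s] id := by
      filter_upwards [(isOpen_lt continuous_abs continuous_const).mem_nhds h] with y hy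
      exact h1 y (le_of_lt hy)
    rw [this.deriv_eq, deriv_id]
  · have hd : Continuous (deriv fun s => s * b s) := hc.continuous_deriv (by simp)
    obtain ⟨D, hD⟩ := hs.deriv.exists_bound_of_continuous hd
    exact ⟨D, (norm_nonneg _).trans (hD 0), hD⟩

/-- The coordinate `y_j` truncated at scale `R`. -/
def truncCoord (θ : ℝ → ℝ) (R : ℝ) (j : Fin 3) (y : R3) : ℝ := R * θ (R⁻¹ * y j)

lemma contDiff_truncCoord {θ : ℝ → ℝ} (hθ : ContDiff ℝ ∞ θ) (R : ℝ) (j : Fin 3) :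
    ContDiff ℝ ∞ (truncCoord θ R j) := by
  have h : ContDiff ℝ ∞ fun y : R3 => y j := (EuclideanSpace.proj (𝕜 := ℝ) j).contDiff
  exact contDiff_const.mul (hθ.comp (contDiff_const.mul h))

lemma fderiv_truncCoord {θ : ℝ → ℝ} (hθ : ContDiff ℝ ∞ θ) {R : ℝ} (hR : 0 < R) (j k : Fin 3)
    (y : R3) : fderiv ℝ (truncCoord θ R j) y (EuclideanSpace.single k 1) =
      if k = j then deriv θ (R⁻¹ * y j) else 0 := by
  have h1 : HasFDerivAt (fun y : R3 => R⁻¹ * y j) (R⁻¹ • EuclideanSpace.proj (𝕜 := ℝ) j) y :=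
    (EuclideanSpace.proj (𝕜 := ℝ) j).hasFDerivAt.const_mul R⁻¹
  have h2 := (((hθ.differentiable (by simp) (R⁻¹ * y j)).hasDerivAt.comp_hasFDerivAt y h1).const_mul
    R).fderiv
  change fderiv ℝ (fun y => R * (θ ∘ fun y : R3 => R⁻¹ * y j) y) y _ = _
  rw [h2]
  have h3 : EuclideanSpace.proj (𝕜 := ℝ) j (EuclideanSpace.single k (1 : ℝ) : R3)
      = if k = j then 1 else 0 := by
    simp [eq_comm]
  simp only [smul_apply, smul_eq_mul, h3]
  split_ifs
  · field_simp
  · simp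

lemma abs_truncCoord_le {θ : ℝ → ℝ} (hθ : ∀ s, |θ s| ≤ 2) {R : ℝ} (hR : 0 < R) (j : Fin 3)
    (y : R3) : |truncCoord θ R j y| ≤ 2 * R := by
  rw [truncCoord, abs_mul, abs_of_pos hR, mul_comm]
  exact mul_le_mul_of_nonneg_right (hθ _) hR.le

lemma isMultiplier_truncCoord {θ : ℝ → ℝ} (hθ : ContDiff ℝ ∞ θ) (hθ2 : ∀ s, |θ s| ≤ 2) {D : ℝ}
    (hD : ∀ s, |deriv θ s| ≤ D) {R : ℝ} (hR : 0 < R) (j : Fin 3) :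
    IsMultiplier fun y => (truncCoord θ R j y : ℂ) := by
  have hc := contDiff_truncCoord hθ R j
  refine IsMultiplier.of_bound (C := 2 * R) (D := D) (Complex.ofRealCLM.contDiff.comp hc)
    (fun y => ?_) fun k y => ?_
  · rw [Complex.norm_real]
    exact abs_truncCoord_le hθ2 hR j y
  · rw [pderiv_ofReal hc, fderiv_truncCoord hθ hR, Complex.norm_real]
    split_ifs
    · exact hD _
    · rw [norm_zero]
      exact (abs_nonneg _).trans (hD 0)

lemma abs_integral_mul_le_of_farSet {w g : R3 → ℝ} (hg : Integrable g) {c : R3} {R A B : ℝ}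
    (hA : 0 ≤ A) (hnear : ∀ y ∉ farSet c R, |w y| ≤ A)
    (hfar : ∀ y ∈ farSet c R, |w y| ≤ B) :
    |∫ y, w y * g y| ≤ A * (∫ y, |g y|) + B * ∫ y in farSet c R, |g y| := by
  have hm := measurableSet_farSet c R
  have hi : Integrable fun y => A * |g y| + B * (farSet c R).indicator (fun y => |g y|) y :=
    (hg.abs.const_mul A).add ((hg.abs.indicator hm).const_mul B)
  have h := norm_integral_le_of_norm_le (f := fun y => w y * g y) hi
    (Eventually.of_forall fun y => ?_)
  · rw [integral_add (hg.abs.const_mul A) ((hg.abs.indicator hm).const_mul B),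
      integral_const_mul, integral_const_mul, integral_indicator hm] at h
    exact h
  · rw [Real.norm_eq_abs, abs_mul]
    by_cases hy : y ∈ farSet c R
    · rw [indicator_of_mem hy]
      nlinarith [mul_le_mul_of_nonneg_right (hfar y hy) (abs_nonneg (g y)),
        mul_nonneg hA (abs_nonneg (g y))]
    · rw [indicator_of_notMem hy]
      nlinarith [mul_le_mul_of_nonneg_right (hnear y hy) (abs_nonneg (g y))]

lemma abs_apply_le_of_notMem_farSet {c y : R3} {R : ℝ} (h : y ∉ farSet c R) (j : Fin 3) :
    |y j - c j| ≤ R := by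
  have h1 : ‖y - c‖ ≤ R := not_lt.1 h
  exact (PiLp.norm_apply_le (y - c) j).trans h1

/-! ### Motion of the center of mass -/

/-- The truncated center of mass of `(f, g)`. -/
def truncCenter (θ : ℝ → ℝ) (R : ℝ) (j : Fin 3) (f g : H1) : ℝ :=
  (∫ y, truncCoord θ R j y * ‖f.fn y‖ ^ 2) + ∫ y, truncCoord θ R j y * ‖g.fn y‖ ^ 2

lemma abs_truncCenter_sub_le {θ : ℝ → ℝ} (hθ : ContDiff ℝ ∞ θ) (hθ1 : ∀ s, |s| ≤ 1 → θ s = s)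
    (hθ2 : ∀ s, |θ s| ≤ 2) {f g : H1} (hmass : mass f g = 1) {c : R3} {R R₀ ε : ℝ} {j : Fin 3}
    (hR₀ : 0 ≤ R₀) (hR : |c j| + R₀ + 1 ≤ R)
    (hf : ∫ y in farSet c R₀, ‖f.fn y‖ ^ 2 ≤ ε) (hg : ∫ y in farSet c R₀, ‖g.fn y‖ ^ 2 ≤ ε) :
    |truncCenter θ R j f g - c j| ≤ R₀ + 6 * R * ε := by
  have hRpos : 0 < R := by linarith [abs_nonneg (c j)]
  have hb : ∀ h : H1, Integrable fun y => truncCoord θ R j y * ‖h.fn y‖ ^ 2 := fun h =>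
    h.integrable_fn_sq.bdd_mul (contDiff_truncCoord hθ R j).continuous.aestronglyMeasurable
      (Eventually.of_forall fun y => abs_truncCoord_le hθ2 hRpos j y)
  have hi : Integrable fun y => ‖f.fn y‖ ^ 2 + ‖g.fn y‖ ^ 2 :=
    f.integrable_fn_sq.add g.integrable_fn_sq
  have e : truncCenter θ R j f g - c j =
      ∫ y, (truncCoord θ R j y - c j) * (‖f.fn y‖ ^ 2 + ‖g.fn y‖ ^ 2) := by
    have e1 : ∀ y, (truncCoord θ R j y - c j) * (‖f.fn y‖ ^ 2 + ‖g.fn y‖ ^ 2) =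
        (truncCoord θ R j y * ‖f.fn y‖ ^ 2 + truncCoord θ R j y * ‖g.fn y‖ ^ 2)
          - c j * (‖f.fn y‖ ^ 2 + ‖g.fn y‖ ^ 2) := fun y => by ring
    simp only [e1]
    have hfg : Integrable fun y => truncCoord θ R j y * ‖f.fn y‖ ^ 2
        + truncCoord θ R j y * ‖g.fn y‖ ^ 2 := (hb f).add (hb g)
    rw [integral_sub hfg (hi.const_mul _), integral_add (hb f) (hb g),
      integral_const_mul, truncCenter]
    rw [mass] at hmass
    rw [hmass, mul_one]
  have h := abs_integral_mul_le_of_farSet (w := fun y => truncCoord θ R j y - c j) hi (c := c)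
    (R := R₀) (A := R₀) (B := 3 * R) hR₀ (fun y hy => ?_) (fun y _ => ?_)
  · have habs : ∀ y, |‖f.fn y‖ ^ 2 + ‖g.fn y‖ ^ 2| = ‖f.fn y‖ ^ 2 + ‖g.fn y‖ ^ 2 :=
      fun y => abs_of_nonneg (by positivity)
    simp only [habs] at h
    rw [← e, integral_add f.integrable_fn_sq.integrableOn g.integrable_fn_sq.integrableOn] at h
    rw [mass] at hmass
    rw [hmass] at h
    nlinarith
  · have h1 := abs_apply_le_of_notMem_farSet hy j
    have h2 : |y j| ≤ R := by
      have := abs_add_le (y j - c j) (c j)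
      rw [sub_add_cancel] at this
      linarith
    have h3 : truncCoord θ R j y = y j := by
      rw [truncCoord, hθ1, mul_inv_cancel_left₀ hRpos.ne']
      rw [abs_mul, abs_of_pos (inv_pos.2 hRpos)]
      exact (inv_mul_le_one₀ hRpos).2 h2
    rw [h3]
    exact h1
  · have h1 := abs_truncCoord_le hθ2 hRpos j y
    have h2 := abs_sub (truncCoord θ R j y) (c j)
    linarith

/-- The time derivative of `truncCenter`. -/
def truncFlux (θ : ℝ → ℝ) (R : ℝ) (j : Fin 3) (f g : H1) : ℝ :=
  2 * ∫ y, deriv θ (R⁻¹ * y j) * (momentumDensity j f y + momentumDensity j g y)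

lemma integrable_deriv_mul {θ : ℝ → ℝ} (hθ : ContDiff ℝ ∞ θ) {D : ℝ}
    (hD : ∀ s, |deriv θ s| ≤ D) (R : ℝ) (j : Fin 3) {g : R3 → ℝ} (hg : Integrable g) :
    Integrable fun y => deriv θ (R⁻¹ * y j) * g y := by
  have hc : Continuous fun y : R3 => deriv θ (R⁻¹ * y j) :=
    (hθ.continuous_deriv (by simp)).comp
      (continuous_const.mul (EuclideanSpace.proj (𝕜 := ℝ) j).continuous)
  exact hg.bdd_mul hc.aestronglyMeasurable (Eventually.of_forall fun y => hD _)

lemma IsSolution.hasDerivAt_truncCenter {β : ℝ} {u v : ℝ → H1} (h : IsSolution β univ u v)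
    {θ : ℝ → ℝ} (hθ : ContDiff ℝ ∞ θ) (hθ2 : ∀ s, |θ s| ≤ 2) {D : ℝ}
    (hD : ∀ s, |deriv θ s| ≤ D) {R : ℝ} (hR : 0 < R) (j : Fin 3) (t : ℝ) :
    HasDerivAt (fun s => truncCenter θ R j (u s) (v s)) (truncFlux θ R j (u t) (v t)) t := by
  have hc := contDiff_truncCoord hθ R j
  have hm := isMultiplier_truncCoord hθ hθ2 hD hR j
  refine ((h.hasDerivAt_localMass hc hm t).add (h.swap.hasDerivAt_localMass hc hm t)).congr_deriv ?_
  simp only [fderiv_truncCoord hθ hR, ite_mul, zero_mul]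
  have hsum : ∀ f : H1, ∑ k, ∫ y, (if k = j then deriv θ (R⁻¹ * y j) * momentumDensity k f y
      else 0) = ∫ y, deriv θ (R⁻¹ * y j) * momentumDensity j f y := by
    intro f
    rw [Finset.sum_eq_single j (fun k _ hk => by simp [hk]) (fun hj => absurd (Finset.mem_univ j) hj)]
    simp
  rw [hsum, hsum, ← mul_add, truncFlux, ← integral_add
    (integrable_deriv_mul hθ hD R j (integrable_momentumDensity j (u t)))
    (integrable_deriv_mul hθ hD R j (integrable_momentumDensity j (v t)))]
  simp only [mul_add]

lemma setIntegral_abs_momentumDensity_le (j : Fin 3) (f : H1) {S : Set R3} {ε : ℝ}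
    (h1 : ∫ y in S, ‖f.fn y‖ ^ 2 ≤ ε) (h2 : ∫ y in S, ‖f.grad j y‖ ^ 2 ≤ ε) :
    ∫ y in S, |momentumDensity j f y| ≤ ε := by
  have h : ∫ y in S, |momentumDensity j f y| ≤
      ∫ y in S, (‖f.fn y‖ ^ 2 + ‖f.grad j y‖ ^ 2) / 2 :=
    integral_mono (integrable_momentumDensity j f).abs.integrableOn
      ((f.integrable_fn_sq.add (f.integrable_grad_sq j)).div_const 2).integrableOn
      (abs_momentumDensity_le j f)
  rw [integral_div, integral_add f.integrable_fn_sq.integrableOn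
    (f.integrable_grad_sq j).integrableOn] at h
  linarith

lemma abs_truncFlux_le {θ : ℝ → ℝ} (hθ : ContDiff ℝ ∞ θ) (hθ3 : ∀ s, |s| < 1 → deriv θ s = 1)
    {D : ℝ} (hD : ∀ s, |deriv θ s| ≤ D) {f g : H1} {j : Fin 3} (hmom : momentum j f g = 0)
    {c : R3} {R R₀ ε : ℝ} (hR₀ : 0 ≤ R₀) (hR : |c j| + R₀ + 1 ≤ R)
    (hf : ∫ y in farSet c R₀, ‖f.fn y‖ ^ 2 ≤ ε) (hg : ∫ y in farSet c R₀, ‖g.fn y‖ ^ 2 ≤ ε)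
    (hf' : ∫ y in farSet c R₀, ‖f.grad j y‖ ^ 2 ≤ ε)
    (hg' : ∫ y in farSet c R₀, ‖g.grad j y‖ ^ 2 ≤ ε) :
    |truncFlux θ R j f g| ≤ 4 * (D + 1) * ε := by
  have hRpos : 0 < R := by linarith [abs_nonneg (c j)]
  have hD0 : 0 ≤ D := (abs_nonneg _).trans (hD 0)
  have hi : Integrable fun y => momentumDensity j f y + momentumDensity j g y :=
    (integrable_momentumDensity j f).add (integrable_momentumDensity j g)
  have e : truncFlux θ R j f g = 2 * ∫ y, (deriv θ (R⁻¹ * y j) - 1) *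
      (momentumDensity j f y + momentumDensity j g y) := by
    simp only [sub_mul, one_mul]
    rw [integral_sub (integrable_deriv_mul hθ hD R j hi) hi, truncFlux]
    rw [momentum] at hmom
    rw [hmom, sub_zero]
  have h := abs_integral_mul_le_of_farSet (w := fun y : R3 => deriv θ (R⁻¹ * y j) - 1) hi (c := c)
    (R := R₀) (A := 0) (B := D + 1) le_rfl (fun y hy => ?_) (fun y _ => ?_)
  · have h2 : ∫ y in farSet c R₀, |momentumDensity j f y + momentumDensity j g y| ≤ ε + ε := by
      refine le_trans ?_ (add_le_add (setIntegral_abs_momentumDensity_le j f hf hf')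
        (setIntegral_abs_momentumDensity_le j g hg hg'))
      rw [← integral_add (integrable_momentumDensity j f).abs.integrableOn
        (integrable_momentumDensity j g).abs.integrableOn]
      exact integral_mono hi.abs.integrableOn ((integrable_momentumDensity j f).abs.add
        (integrable_momentumDensity j g).abs).integrableOn fun y => abs_add_le _ _
    rw [e, abs_mul, abs_two]
    nlinarith
  · have h1 := abs_apply_le_of_notMem_farSet hy j
    have h2 : |y j| < R := by
      have := abs_add_le (y j - c j) (c j)
      rw [sub_add_cancel] at this
      linarith
    rw [hθ3, sub_self, abs_zero]
    rw [abs_mul, abs_of_pos (inv_pos.2 hRpos)]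
    exact (inv_mul_lt_one₀ hRpos).2 h2
  · have h2 := abs_sub (deriv θ (R⁻¹ * y j)) 1
    have h3 := hD (R⁻¹ * y j)
    rw [abs_one] at h2
    linarith

/-- A family of `H¹` pairs is localized about `c(t)` at scale `R₀` up to error `ε`. -/
def IsLocalized (u v : ℝ → H1) (c : ℝ → R3) (R₀ ε : ℝ) : Prop := ∀ t, 0 ≤ t →
  ((∫ y in farSet (c t) R₀, ‖(u t).fn y‖ ^ 2 ≤ ε) ∧
    ∫ y in farSet (c t) R₀, ‖(v t).fn y‖ ^ 2 ≤ ε) ∧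
  ∀ j, (∫ y in farSet (c t) R₀, ‖(u t).grad j y‖ ^ 2 ≤ ε) ∧
    ∫ y in farSet (c t) R₀, ‖(v t).grad j y‖ ^ 2 ≤ ε

theorem IsCriticalSolution.abs_center_le {β r₁ : ℝ} {P Q : H1} {u v : ℝ → H1}
    (h : IsCriticalSolution β r₁ P Q u v) {θ : ℝ → ℝ} (hθ : ContDiff ℝ ∞ θ)
    (hθ1 : ∀ s, |s| ≤ 1 → θ s = s) (hθ2 : ∀ s, |θ s| ≤ 2) (hθ3 : ∀ s, |s| < 1 → deriv θ s = 1)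
    {D : ℝ} (hD : ∀ s, |deriv θ s| ≤ D) {c : ℝ → R3} (hc : ContinuousOn c (Ici 0)) {R₀ ε : ℝ}
    (hR₀ : 0 ≤ R₀) (hε : 0 ≤ ε) (hε' : ε ≤ 1 / 24) (hloc : IsLocalized u v c R₀ ε) (j : Fin 3)
    {T : ℝ} (hT : 0 ≤ T) :
    |c T j| ≤ 2 * |c 0 j| + 5 * R₀ + 1 + 8 * (D + 1) * ε * T := by
  have hD0 : 0 ≤ D := (abs_nonneg _).trans (hD 0)
  have hcj : ContinuousOn (fun t => |c t j|) (Icc 0 T) :=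
    (((EuclideanSpace.proj (𝕜 := ℝ) j).continuous.comp_continuousOn
      (hc.mono Icc_subset_Ici_self))).abs
  obtain ⟨T', hT', hmax⟩ := isCompact_Icc.exists_isMaxOn (nonempty_Icc.2 hT) hcj
  set ρ := |c T' j| with hρ
  have hle : ∀ t ∈ Icc 0 T, |c t j| ≤ ρ := fun t ht => hmax ht
  set R := ρ + R₀ + 1 with hR
  have hρ0 : 0 ≤ ρ := abs_nonneg _
  have hRpos : 0 < R := by positivity
  have hcenter : ∀ t ∈ Icc 0 T, |truncCenter θ R j (u t) (v t) - c t j| ≤ R₀ + 6 * R * ε := by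
    intro t ht
    obtain ⟨⟨h1, h2⟩, _⟩ := hloc t ht.1
    exact abs_truncCenter_sub_le hθ hθ1 hθ2 (h.mass_eq t) hR₀ (by linarith [hle t ht]) h1 h2
  have hmove := norm_image_sub_le_of_norm_deriv_le_segment'
    (f := fun t => truncCenter θ R j (u t) (v t))
    (f' := fun t => truncFlux θ R j (u t) (v t)) (a := 0) (b := T) (C := 4 * (D + 1) * ε)
    (fun t _ => (h.isSolution.hasDerivAt_truncCenter hθ hθ2 hD hRpos j t).hasDerivWithinAt)
    (fun t ht => by
      obtain ⟨⟨h1, h2⟩, h3⟩ := hloc t ht.1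
      exact abs_truncFlux_le hθ hθ3 hD (h.momentum_eq_zero t j) hR₀
        (by linarith [hle t (Ico_subset_Icc_self ht)]) h1 h2 (h3 j).1 (h3 j).2) T' hT'
  rw [Real.norm_eq_abs, sub_zero] at hmove
  have h1 := abs_le.1 (hcenter T' hT')
  have h2 := abs_le.1 (hcenter 0 ⟨le_rfl, hT⟩)
  have h3 := abs_le.1 hmove
  have h4 := neg_abs_le (c 0 j)
  have h5 := le_abs_self (c 0 j)
  have h6 : 4 * (D + 1) * ε * T' ≤ 4 * (D + 1) * ε * T :=
    mul_le_mul_of_nonneg_left hT'.2 (by positivity)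
  have h7 : ρ ≤ |c 0 j| + 2 * (R₀ + 6 * R * ε) + 4 * (D + 1) * ε * T := by
    rw [hρ, abs_le]
    constructor <;> linarith
  have h8 : R * ε ≤ R * (1 / 24) := mul_le_mul_of_nonneg_left hε' hRpos.le
  have h9 := hle T ⟨hT, le_rfl⟩
  linarith

theorem exists_isLocalized {u v : ℝ → H1} {x : ℝ → R3}
    (hpre : IsCompact (closure {p : H1 × H1 |
      ∃ t : ℝ, 0 ≤ t ∧ p = ((u t).translate (x t), (v t).translate (x t))}))
    {ε : ℝ} (hε : 0 < ε) : ∃ R₀ : ℝ, 0 ≤ R₀ ∧ IsLocalized u v (fun t => -x t) R₀ ε := by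
  set K := closure {p : H1 × H1 |
      ∃ t : ℝ, 0 ≤ t ∧ p = ((u t).translate (x t), (v t).translate (x t))} with hK
  have hmem : ∀ t, 0 ≤ t → ((u t).translate (x t), (v t).translate (x t)) ∈ K :=
    fun t ht => subset_closure ⟨t, ht, rfl⟩
  have key : ∀ L : H1 →L[ℂ] L2, (∀ a f, L (f.translate a) = translateL2 a (L f)) →
      ∃ R : ℝ, 0 ≤ R ∧ ∀ t, 0 ≤ t → ∀ R', R ≤ R' →
        (∫ y in farSet (-x t) R', ‖L (u t) y‖ ^ 2 ≤ ε) ∧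
          ∫ y in farSet (-x t) R', ‖L (v t) y‖ ^ 2 ≤ ε := by
    intro L hL
    obtain ⟨R, hR0, hR⟩ := exists_uniform_tail
      ((hpre.image (L.continuous.comp continuous_fst)).union
        (hpre.image (L.continuous.comp continuous_snd))) hε
    refine ⟨R, hR0, fun t ht R' hR' => ⟨?_, ?_⟩⟩
    · refine (L2.setIntegral_farSet_anti _ _ hR').trans ?_
      rw [← setIntegral_translateL2, ← hL]
      exact hR _ (Or.inl ⟨_, hmem t ht, rfl⟩)
    · refine (L2.setIntegral_farSet_anti _ _ hR').trans ?_
      rw [← setIntegral_translateL2, ← hL]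
      exact hR _ (Or.inr ⟨_, hmem t ht, rfl⟩)
  obtain ⟨R, hR0, hR⟩ := key H1.fnL fun _ _ => rfl
  choose S hS0 hS using fun j => key (H1.gradL j) fun _ _ => rfl
  refine ⟨R + ∑ j, S j, add_nonneg hR0 (Finset.sum_nonneg fun j _ => hS0 j), fun t ht => ⟨?_, ?_⟩⟩
  · exact hR t ht _ (le_add_of_nonneg_right (Finset.sum_nonneg fun j _ => hS0 j))
  · exact fun j => hS j t ht _ ((Finset.single_le_sum (fun j _ => hS0 j)
      (Finset.mem_univ j)).trans (le_add_of_nonneg_left hR0))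

theorem IsCriticalSolution.tendsto_center_div {β r₁ : ℝ} {P Q : H1} {u v : ℝ → H1}
    (h : IsCriticalSolution β r₁ P Q u v) {x : ℝ → R3} (hx : ContinuousOn x (Ici 0))
    (hpre : IsCompact (closure {p : H1 × H1 |
      ∃ t : ℝ, 0 ≤ t ∧ p = ((u t).translate (x t), (v t).translate (x t))})) (j : Fin 3) :
    Tendsto (fun t => |x t j| / t) atTop (𝓝 0) := by
  obtain ⟨θ, hθ, hθ1, hθ2, hθ3, D, hD0, hD⟩ := exists_truncation
  rw [Metric.tendsto_nhds]
  intro δ hδ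
  set ε := min (1 / 24) (δ / (16 * (D + 1))) with hε
  have hεpos : 0 < ε := lt_min (by norm_num) (by positivity)
  obtain ⟨R₀, hR₀, hloc⟩ := exists_isLocalized hpre hεpos
  set A := 2 * |x 0 j| + 5 * R₀ + 1 with hA
  have hApos : 0 < A := by positivity
  filter_upwards [eventually_gt_atTop (2 * A / δ), eventually_gt_atTop 0] with T hT hT0
  have h1 := h.abs_center_le hθ hθ1 hθ2 hθ3 hD hx.neg hR₀ hεpos.le (min_le_left _ _) hloc j hT0.le
  simp only [Pi.neg_apply, PiLp.neg_apply, abs_neg] at h1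
  have h2 : 8 * (D + 1) * ε ≤ δ / 2 := by
    calc 8 * (D + 1) * ε ≤ 8 * (D + 1) * (δ / (16 * (D + 1))) := by
          gcongr; exact min_le_right _ _
      _ = δ / 2 := by field_simp; norm_num
  have h3 : 2 * A < T * δ := (div_lt_iff₀ hδ).1 hT
  rw [Real.dist_0_eq_abs, abs_of_nonneg (by positivity), div_lt_iff₀ hT0]
  have h4 := mul_le_mul_of_nonneg_right h2 hT0.le
  linarith

end NLSSystem

end

theorem lemma6p2 (β : ℝ) (hβ : 0 < β) (r₁ : ℝ) (hr₁ : 3 < r₁) (hr₁' : r₁ < 6)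
    (P Q : NLSSystem.H1) (hPQ : NLSSystem.IsGroundState β P Q)
    (u v : ℝ → NLSSystem.H1) (huv : NLSSystem.IsCriticalSolution β r₁ P Q u v)
    (x : ℝ → NLSSystem.R3) (hx : ContinuousOn x (Ici 0))
    (hpre : IsCompact (closure {p : NLSSystem.H1 × NLSSystem.H1 |
      ∃ t : ℝ, 0 ≤ t ∧ p = ((u t).translate (x t), (v t).translate (x t))})) :
    Tendsto (fun t => ‖x t‖ / t) atTop (𝓝 0) := by
  have h : Tendsto (fun t => ∑ j, |x t j| / t) atTop (𝓝 (∑ _j : Fin 3, 0)) :=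
    tendsto_finsetSum _ fun j _ => huv.tendsto_center_div hx hpre j
  rw [Finset.sum_const_zero] at h
  refine squeeze_zero' ?_ ?_ h
  · filter_upwards [eventually_ge_atTop 0] with t ht
    positivity
  · filter_upwards [eventually_ge_atTop 0] with t ht
    rw [← Finset.sum_div]
    refine div_le_div_of_nonneg_right ?_ ht
    rw [EuclideanSpace.norm_eq]
    refine Real.sqrt_le_iff.2 ⟨Finset.sum_nonneg fun j _ => abs_nonneg _, ?_⟩
    exact Finset.sum_sq_le_sq_sum_of_nonneg fun _ _ => abs_nonneg _
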